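/- Let $k$ be a commutative ring and let $(U_h,A_h)$, with source map $s$, target map $t$, coproduct $\Delta_h$ and counit $\epsilon_h$, be a quantum left bialgebroid: a left bialgebroid over $k[[h]]$ that is topological for the $h$-adic topology (i.e. $\Delta_h$ takes values in the Takeuchi–Sweedler product inside the $h$-adically completed tensor product ${U_h}_{\triangleleft}\,\widehat\otimes_{A_h}\,{}_{\triangleright}U_h$), together with isomorphisms of $k[[h]]$-modules $A_h\cong A[[h]]$, $U_h\cong U[[h]]$ which modulo $h$ become an isomorphism of left bialgebroids $(U_h/hU_h,A_h/hA_h)\cong(U,A)$ for a left bialgebroid $(U,A)$ over $k$. Write $a\triangleright u\triangleleft b=s(a)t(b)u$ and $a\blacktriangleright u\blacktriangleleft b=u\,t(a)s(b)$ on $U_h$; for a left $U_h$-module $M$ write $a\triangleright m\triangleleft b=s(a)t(b)m$, and for a right $U_h$-module $N$ write $a\blacktriangleright n\blacktriangleleft b=n\,t(a)s(b)$. For right $U_h$-modules $P,N$ put $\mathrm{Hom}_{A_h^{\rm op}}(P,N)=\mathrm{Hom}_{A_h^{\rm op}}(P_{\blacktriangleleft},N_{\blacktriangleleft})$, with $(\phi\triangleleft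 a)(p)=\phi(a\blacktriangleright p)$. Assume that $(U_h,A_h)$ is simultaneously a quantum left and right Hopf algebroid, i.e. that the two Hopf–Galois maps $$\alpha_\ell:{}_{\blacktriangleright}U_h\,\widehat\otimes_{A_h^{\rm op}}\,{U_h}_{\triangleleft}\to {U_h}_{\triangleleft}\,\widehat\otimes_{A_h}\,{}_{\triangleright}U_h,\quad u\otimes v\mapsto u_{(1)}\otimes u_{(2)}v,$$ $$\alpha_r:{U_h}_{\blacktriangleleft}\,\widehat\otimes^{A_h}\,{}_{\triangleright}U_h\to {U_h}_{\triangleleft}\,\widehat\otimes_{A_h}\,{}_{\triangleright}U_h,\quad u\otimes v\mapsto u_{(1)}v\otimes u_{(2)}$$ are bijective, and write $u_+\otimes u_-=\alpha_\ell^{-1}(u\otimes1)$, $u_{[+]}\otimes u_{[-]}=\alpha_r^{-1}(1\otimes u)$. Let $P_h$ be a right $U_h$-module such that ${P_h}_{\blacktriangleleft}$ is finitely generated projective over $A_h^{\rm op}$ and ${}_{\blacktriangleright}P_h$ is finitely generated projective over $A_h$, and such that 1. the map $A_h\to\mathrm{Hom}_{A_h^{\rm op}}(P_h,P_h)$, $a\mapsto\{p\mapsto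 a\blacktriangleright p\}$, is an isomorphism of $k[[h]]$-modules; 2. for every right $U_h$-module $N_h$ that is (separated and) complete for the $h$-adic topology, the evaluation map ${}_{\blacktriangleright}P_h\otimes_{A_h^{\rm op}}\mathrm{Hom}_{A_h^{\rm op}}(P_h,N_h)_{\triangleleft}\to N_h$, $p\otimes\phi\mapsto\phi(p)$, is an isomorphism. Then $M_h\mapsto{}_{\blacktriangleright}P_h\otimes_{A_h^{\rm op}}{M_h}_{\triangleleft}$, with right $U_h$-action $(p\otimes m)u=pu_+\otimes u_-m$, is an equivalence from the category of $h$-adically complete left $U_h$-modules to the category of $h$-adically complete right $U_h$-modules, with quasi-inverse $N_h\mapsto\mathrm{Hom}_{A_h^{\rm op}}(P_h,N_h)$, with left $U_h$-action $(u\phi)(p)=\phi(pu_{[+]})u_{[-]}$. (Here $u_+\otimes u_-$ and $u_{[+]}\otimes u_{[-]}$ lie in completed tensor products, and the right-hand sides are the corresponding $h$-adic limits.) -/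

import Mathlib

open TensorProduct MulOpposite CategoryTheory

universe v

namespace HopfAlgd

/-! ## Balanced tensor products over a noncommutative algebra -/

section Balanced

variable {R : Type*} [CommRing R] {A M N Q : Type*}
  [AddCommGroup M] [Module R M] [AddCommGroup N] [Module R N] [AddCommGroup Q] [Module R Q]

/-- The relations `(m·a) ⊗ n = m ⊗ (a·n)`, where `f a` is the operator `m ↦ m·a` on `M` and `g a`
is the operator `n ↦ a·n` on `N`. -/
def balancedRel (f : A → Module.End R M) (g : A → Module.End R N) : Submodule R (M ⊗[R] N) :=
  Submodule.span R {z | ∃ a m n, z = f a m ⊗ₜ[R] n - m ⊗ₜ[R] g a n}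

/-- The tensor product of `M` and `N` over the `R`-algebra that acts on `M` through `f` and on `N`
through `g`, as an `R`-module. -/
abbrev BalTensor (f : A → Module.End R M) (g : A → Module.End R N) : Type _ :=
  (M ⊗[R] N) ⧸ balancedRel f g

/-- The class of `m ⊗ n`. -/
def BalTensor.tmul (f : A → Module.End R M) (g : A → Module.End R N) (m : M) (n : N) :
    BalTensor f g :=
  (balancedRel f g).mkQ (m ⊗ₜ[R] n)

/-- The linear map out of a balanced tensor product induced by a balanced bilinear map. -/
def BalTensor.lift {f : A → Module.End R M} {g : A → Module.End R N} (b : M →ₗ[R] N →ₗ[R] Q)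
    (hb : ∀ a m n, b (f a m) n = b m (g a n)) : BalTensor f g →ₗ[R] Q :=
  (balancedRel f g).liftQ (TensorProduct.lift b) (by
    refine Submodule.span_le.2 ?_
    rintro z ⟨a, m, n, rfl⟩
    simp [hb])

theorem BalTensor.lift_tmul {f : A → Module.End R M} {g : A → Module.End R N}
    (b : M →ₗ[R] N →ₗ[R] Q) (hb : ∀ a m n, b (f a m) n = b m (g a n)) (m : M) (n : N) :
    BalTensor.lift b hb (BalTensor.tmul f g m n) = b m n := rfl

theorem BalTensor.tmul_eq (f : A → Module.End R M) (g : A → Module.End R N) (a : A) (m : M)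
    (n : N) : BalTensor.tmul f g (f a m) n = BalTensor.tmul f g m (g a n) := by
  rw [← sub_eq_zero, BalTensor.tmul, BalTensor.tmul, ← map_sub, Submodule.mkQ_apply,
    Submodule.Quotient.mk_eq_zero]
  exact Submodule.subset_span ⟨a, m, n, rfl⟩

/-- The canonical bilinear map `(m, n) ↦ m ⊗ n`. -/
def BalTensor.mk (f : A → Module.End R M) (g : A → Module.End R N) :
    M →ₗ[R] N →ₗ[R] BalTensor f g :=
  (TensorProduct.mk R M N).compr₂ (balancedRel f g).mkQ

theorem BalTensor.mk_apply (f : A → Module.End R M) (g : A → Module.End R N) (m : M) (n : N) :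
    BalTensor.mk f g m n = BalTensor.tmul f g m n := rfl

theorem BalTensor.hom_ext {f : A → Module.End R M} {g : A → Module.End R N}
    {φ ψ : BalTensor f g →ₗ[R] Q}
    (h : ∀ m n, φ (BalTensor.tmul f g m n) = ψ (BalTensor.tmul f g m n)) : φ = ψ := by
  refine Submodule.linearMap_qext _ (TensorProduct.ext' fun m n => ?_)
  exact h m n

end Balanced

/-! ## Extension of linear maps to completions -/

section Completion

variable {R : Type*} [CommRing R] (I : Ideal R) {S T : Type*}
  [AddCommGroup S] [Module R S] [AddCommGroup T] [Module R T]

/-- The continuous extension `T^ → S^` of a linear map `T → S^`, given modulo `I ^ n` by the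
induced maps `T / I ^ n T → S / I ^ n S`. -/
noncomputable def hatExtend (g : T →ₗ[R] AdicCompletion I S) :
    AdicCompletion I T →ₗ[R] AdicCompletion I S :=
  AdicCompletion.lift I
    (fun n => ((I ^ n • ⊤ : Submodule R T).liftQ (AdicCompletion.eval I S n ∘ₗ g) (by
      refine Submodule.smul_le.2 fun r hr x _ => ?_
      rw [LinearMap.mem_ker, map_smul]
      obtain ⟨y, hy⟩ := Submodule.mkQ_surjective _ ((AdicCompletion.eval I S n ∘ₗ g) x)
      rw [← hy, ← map_smul, Submodule.mkQ_apply, Submodule.Quotient.mk_eq_zero]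
      exact Submodule.smul_mem_smul hr trivial)) ∘ₗ AdicCompletion.eval I T n)
    (by
      intro m n hle
      refine LinearMap.ext fun x => ?_
      obtain ⟨y, hy⟩ := Submodule.mkQ_surjective _ (AdicCompletion.eval I T n x)
      have hy' : (I ^ m • ⊤ : Submodule R T).mkQ y = AdicCompletion.eval I T m x := by
        rw [AdicCompletion.eval_apply I T m x,
          ← AdicCompletion.transitionMap_comp_eval_apply (I := I) (M := T) hle x,
          ← AdicCompletion.eval_apply, ← hy]
        rfl
      simp only [LinearMap.comp_apply]
      rw [← hy, ← hy']
      exact AdicCompletion.transitionMap_comp_eval_apply (I := I) (M := S) hle (g y))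

theorem hatExtend_of (g : T →ₗ[R] AdicCompletion I S) (x : T) :
    hatExtend I g (AdicCompletion.of I T x) = g x := by
  refine AdicCompletion.ext fun n => ?_
  rfl

theorem adicMap_add (e f : T →ₗ[R] S) (w : AdicCompletion I T) :
    AdicCompletion.map I (e + f) w = AdicCompletion.map I e w + AdicCompletion.map I f w := by
  refine AdicCompletion.ext fun n => ?_
  rw [AdicCompletion.val_add_apply]
  simp only [AdicCompletion.map_val_apply]
  obtain ⟨z, hz⟩ := Submodule.mkQ_surjective _ (w.val n)
  rw [← hz]
  simp

theorem adicMap_smul (c : R) (e : T →ₗ[R] S) (w : AdicCompletion I T) :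
    AdicCompletion.map I (c • e) w = c • AdicCompletion.map I e w := by
  refine AdicCompletion.ext fun n => ?_
  rw [AdicCompletion.val_smul_apply]
  simp only [AdicCompletion.map_val_apply]
  obtain ⟨z, hz⟩ := Submodule.mkQ_surjective _ (w.val n)
  rw [← hz]
  simp

end Completion

/-! ## Left bialgebroids -/

/-- An `Aᵉ`-ring `U` over `R`: the source map `s : A → U` and the target map `t : Aᵒᵖ → U`
(written as a homomorphism `A → Uᵒᵖ`), with commuting images. -/
structure AeRing (R A U : Type*) [CommRing R] [Ring A] [Algebra R A] [Ring U] [Algebra R U] where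
  /-- the source map -/
  s : A →ₐ[R] U
  /-- the target map, as a homomorphism into the opposite algebra -/
  t : A →ₐ[R] Uᵐᵒᵖ
  comm : ∀ a b, s a * unop (t b) = unop (t b) * s a

namespace AeRing

variable {R A U : Type*} [CommRing R] [Ring A] [Algebra R A] [Ring U] [Algebra R U]
  (E : AeRing R A U)

/-- The element `t(a)` of `U`. -/
def tgt (a : A) : U := unop (E.t a)

/-- `U_◁ ⊗_A ▷U`: the tensor product with relations `t(a)u ⊗ v = u ⊗ s(a)v`. -/
abbrev Tens : Type _ :=
  BalTensor (fun a => LinearMap.mulLeft R (E.tgt a)) (fun a => LinearMap.mulLeft R (E.s a))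

/-- The class of `u ⊗ v` in `U_◁ ⊗_A ▷U`. -/
abbrev tens (u v : U) : E.Tens :=
  BalTensor.tmul (fun a => LinearMap.mulLeft R (E.tgt a)) (fun a => LinearMap.mulLeft R (E.s a)) u v

/-- `▸U ⊗_{Aᵒᵖ} U_◁`: the tensor product with relations `u t(a) ⊗ v = u ⊗ t(a)v`. -/
abbrev TensL : Type _ :=
  BalTensor (fun a => LinearMap.mulRight R (E.tgt a)) (fun a => LinearMap.mulLeft R (E.tgt a))

/-- The class of `u ⊗ v` in `▸U ⊗_{Aᵒᵖ} U_◁`. -/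
abbrev tensL (u v : U) : E.TensL :=
  BalTensor.tmul (fun a => LinearMap.mulRight R (E.tgt a))
    (fun a => LinearMap.mulLeft R (E.tgt a)) u v

/-- `U_◂ ⊗^A ▷U`: the tensor product with relations `u s(a) ⊗ v = u ⊗ s(a)v`. -/
abbrev TensR : Type _ :=
  BalTensor (fun a => LinearMap.mulRight R (E.s a)) (fun a => LinearMap.mulLeft R (E.s a))

/-- The class of `u ⊗ v` in `U_◂ ⊗^A ▷U`. -/
abbrev tensR (u v : U) : E.TensR :=
  BalTensor.tmul (fun a => LinearMap.mulRight R (E.s a))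
    (fun a => LinearMap.mulLeft R (E.s a)) u v

/-- The relations of the threefold tensor product `U_◁ ⊗_A ▷U_◁ ⊗_A ▷U`. -/
def rel₃ : Submodule R (U ⊗[R] (U ⊗[R] U)) :=
  Submodule.span R
    ({z | ∃ (a : A) (u v w : U),
        z = (E.tgt a * u) ⊗ₜ[R] (v ⊗ₜ[R] w) - u ⊗ₜ[R] ((E.s a * v) ⊗ₜ[R] w)} ∪
     {z | ∃ (a : A) (u v w : U),
        z = u ⊗ₜ[R] ((E.tgt a * v) ⊗ₜ[R] w) - u ⊗ₜ[R] (v ⊗ₜ[R] (E.s a * w))})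

/-- `U_◁ ⊗_A ▷U_◁ ⊗_A ▷U`. -/
abbrev Tens₃ : Type _ := (U ⊗[R] (U ⊗[R] U)) ⧸ E.rel₃

/-- The map `u ⊗ v ↦ u ⊗ v ⊗ w`. -/
noncomputable def insertRight (w : U) : E.Tens →ₗ[R] E.Tens₃ :=
  BalTensor.lift
    (LinearMap.compr₂
      ((TensorProduct.mk R U (U ⊗[R] U)).compl₂ ((TensorProduct.mk R U U).flip w)) E.rel₃.mkQ)
    (fun a u v => by
      rw [← sub_eq_zero]
      simp only [LinearMap.compr₂_apply, LinearMap.compl₂_apply, TensorProduct.mk_apply,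
        LinearMap.flip_apply, LinearMap.mulLeft_apply, ← map_sub]
      exact (Submodule.Quotient.mk_eq_zero _).2 (Submodule.subset_span (Or.inl ⟨a, u, v, w, rfl⟩)))

/-- The map `v ⊗ w ↦ u ⊗ v ⊗ w`. -/
noncomputable def insertLeft (u : U) : E.Tens →ₗ[R] E.Tens₃ :=
  BalTensor.lift
    (LinearMap.compr₂ (TensorProduct.mk R U U)
      (E.rel₃.mkQ ∘ₗ TensorProduct.mk R U (U ⊗[R] U) u))
    (fun a v w => by
      rw [← sub_eq_zero]
      simp only [LinearMap.compr₂_apply, LinearMap.comp_apply, TensorProduct.mk_apply,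
        LinearMap.mulLeft_apply, ← map_sub]
      exact (Submodule.Quotient.mk_eq_zero _).2 (Submodule.subset_span (Or.inr ⟨a, u, v, w, rfl⟩)))

/-- Right multiplication `u ⊗ v ↦ u a ⊗ v b` on `U_◁ ⊗_A ▷U`. -/
noncomputable def rmul (a b : U) : E.Tens →ₗ[R] E.Tens :=
  BalTensor.lift
    (LinearMap.compl₁₂ (BalTensor.mk (fun a => LinearMap.mulLeft R (E.tgt a))
        (fun a => LinearMap.mulLeft R (E.s a))) (LinearMap.mulRight R a) (LinearMap.mulRight R b))
    (fun c u v => by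
      simp only [LinearMap.compl₁₂_apply, BalTensor.mk_apply, LinearMap.mulRight_apply,
        LinearMap.mulLeft_apply, mul_assoc]
      exact BalTensor.tmul_eq (fun a => LinearMap.mulLeft R (E.tgt a))
        (fun a => LinearMap.mulLeft R (E.s a)) c (u * a) (v * b))

theorem rmul_tens (a b u v : U) : E.rmul a b (E.tens u v) = E.tens (u * a) (v * b) :=
  BalTensor.lift_tmul _ _ u v

variable (I : Ideal R)

/-- The class of `∑ᵢ xᵢ ⊗ yᵢ` in `(U_◁ ⊗_A ▷U) / I ^ n`. -/
noncomputable def sumMod (n : ℕ) {m : ℕ} (x y : Fin m → U) :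
    E.Tens ⧸ (I ^ n • ⊤ : Submodule R E.Tens) :=
  Submodule.mkQ _ (∑ i, E.tens (x i) (y i))

/-- `w ≡ ∑ᵢ xᵢ ⊗ yᵢ` modulo `I ^ n`, for `w` in the completed tensor product `U_◁ ⊗^_A ▷U`. -/
def Approx (n : ℕ) (w : AdicCompletion I E.Tens) {m : ℕ} (x y : Fin m → U) : Prop :=
  AdicCompletion.eval I E.Tens n w = E.sumMod I n x y

end AeRing

/-- A left bialgebroid `(U, A)` over `R`, topological for the `I`-adic topology: the coproduct has
values in the `I`-adic completion of `U_◁ ⊗_A ▷U`. For `I = ⊥` the completion does nothing (see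
`of_bot_bijective`), and this is an ordinary left bialgebroid. Identities in a completed tensor
product are identities modulo every `I ^ n`, and modulo `I ^ n` they are written with
representatives `Δ(u) ≡ ∑ᵢ xᵢ ⊗ yᵢ`. -/
structure LeftBialgebroid {R : Type*} [CommRing R] (I : Ideal R) (A U : Type*) [Ring A]
    [Algebra R A] [Ring U] [Algebra R U] extends AeRing R A U where
  complete_base : IsAdicComplete I A
  complete_total : IsAdicComplete I U
  /-- the coproduct -/
  comul : U →ₗ[R] AdicCompletion I toAeRing.Tens
  /-- the counit -/
  counit : U →ₗ[R] A
  /-- `Δ(s(a) t(b) u) = s(a) u₁ ⊗ t(b) u₂` -/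
  comul_bimod : ∀ (a b : A) (u : U) (n m : ℕ) (x y : Fin m → U),
    toAeRing.Approx I n (comul u) x y →
    toAeRing.Approx I n (comul (s a * toAeRing.tgt b * u))
      (fun i => s a * x i) (fun i => toAeRing.tgt b * y i)
  /-- `Δ(u)` lies in the Takeuchi product: `u₁ t(a) ⊗ u₂ = u₁ ⊗ u₂ s(a)` -/
  comul_takeuchi : ∀ (a : A) (u : U),
    AdicCompletion.map I (toAeRing.rmul (toAeRing.tgt a) 1) (comul u) =
      AdicCompletion.map I (toAeRing.rmul 1 (s a)) (comul u)
  comul_one : comul 1 = AdicCompletion.of I _ (toAeRing.tens 1 1)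
  /-- `Δ(uv) = u₁ v₁ ⊗ u₂ v₂` -/
  comul_mul : ∀ (u v : U) (n m l : ℕ) (x y : Fin m → U) (x' y' : Fin l → U),
    toAeRing.Approx I n (comul u) x y → toAeRing.Approx I n (comul v) x' y' →
    AdicCompletion.eval I _ n (comul (u * v)) =
      Submodule.mkQ _ (∑ i, ∑ j, toAeRing.tens (x i * x' j) (y i * y' j))
  /-- `Δ(u₁) ⊗ u₂ = u₁ ⊗ Δ(u₂)` -/
  coassoc : ∀ (u : U) (n m : ℕ) (x y : Fin m → U), toAeRing.Approx I n (comul u) x y →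
    AdicCompletion.eval I toAeRing.Tens₃ n
        (∑ i, AdicCompletion.map I (toAeRing.insertRight (y i)) (comul (x i))) =
      AdicCompletion.eval I toAeRing.Tens₃ n
        (∑ i, AdicCompletion.map I (toAeRing.insertLeft (x i)) (comul (y i)))
  /-- `s(ε(u₁)) u₂ = u` -/
  counit_left : ∀ (u : U) (n m : ℕ) (x y : Fin m → U), toAeRing.Approx I n (comul u) x y →
    ∑ i, s (counit (x i)) * y i - u ∈ (I ^ n • ⊤ : Submodule R U)
  /-- `t(ε(u₂)) u₁ = u` -/
  counit_right : ∀ (u : U) (n m : ℕ) (x y : Fin m → U), toAeRing.Approx I n (comul u) x y →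
    ∑ i, toAeRing.tgt (counit (y i)) * x i - u ∈ (I ^ n • ⊤ : Submodule R U)
  counit_one : counit 1 = 1
  counit_bimod : ∀ (a b : A) (u : U), counit (s a * toAeRing.tgt b * u) = a * counit u * b
  counit_mul_s : ∀ u v : U, counit (u * v) = counit (u * s (counit v))
  counit_mul_t : ∀ u v : U, counit (u * v) = counit (u * toAeRing.tgt (counit v))

/-- The `⊥`-adic completion of a module is the module itself. -/
theorem of_bot_bijective (R M : Type*) [CommRing R] [AddCommGroup M] [Module R M] :
    Function.Bijective (AdicCompletion.of (⊥ : Ideal R) M) :=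
  AdicCompletion.of_bijective_iff.2 ⟨⟩

namespace LeftBialgebroid

variable {R : Type*} [CommRing R] {I : Ideal R} {A U : Type*} [Ring A] [Algebra R A] [Ring U]
  [Algebra R U] (B : LeftBialgebroid I A U)

theorem exists_approx (n : ℕ) (w : AdicCompletion I B.Tens) :
    ∃ (m : ℕ) (x y : Fin m → U), B.Approx I n w x y := by
  obtain ⟨z, hz⟩ := Submodule.mkQ_surjective _ (AdicCompletion.eval I B.Tens n w)
  obtain ⟨z', rfl⟩ := Submodule.mkQ_surjective _ z
  obtain ⟨m, x, y, h⟩ : ∃ (m : ℕ) (x y : Fin m → U), z' = ∑ i, x i ⊗ₜ[R] y i := by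
    induction z' using TensorProduct.induction_on generalizing w with
    | zero => exact ⟨0, Fin.elim0, Fin.elim0, by simp⟩
    | tmul u v => exact ⟨1, fun _ => u, fun _ => v, by simp⟩
    | add a b ha hb =>
      obtain ⟨m, x, y, h⟩ := ha (AdicCompletion.of I _ (Submodule.mkQ _ a)) rfl
      obtain ⟨l, x', y', h'⟩ := hb (AdicCompletion.of I _ (Submodule.mkQ _ b)) rfl
      refine ⟨m + l, Fin.append x x', Fin.append y y', ?_⟩
      rw [Fin.sum_univ_add, h, h']
      simp
  refine ⟨m, x, y, ?_⟩
  rw [AeRing.Approx, ← hz, h, map_sum]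
  rfl

theorem comul_t (b : A) : B.comul (B.tgt b) = AdicCompletion.of I _ (B.tens 1 (B.tgt b)) := by
  refine AdicCompletion.ext fun n => ?_
  have h := B.comul_bimod 1 b 1 n 1 (fun _ => 1) (fun _ => 1)
    (by simp [AeRing.Approx, AeRing.sumMod, B.comul_one])
  simpa [AeRing.Approx, AeRing.sumMod] using h

theorem comul_s (a : A) : B.comul (B.s a) = AdicCompletion.of I _ (B.tens (B.s a) 1) := by
  refine AdicCompletion.ext fun n => ?_
  have h := B.comul_bimod a 1 1 n 1 (fun _ => 1) (fun _ => 1)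
    (by simp [AeRing.Approx, AeRing.sumMod, B.comul_one])
  simpa [AeRing.Approx, AeRing.sumMod, AeRing.tgt] using h

theorem comul_mul_of (u v p q : U) (h : B.comul v = AdicCompletion.of I _ (B.tens p q)) :
    B.comul (u * v) = AdicCompletion.map I (B.rmul p q) (B.comul u) := by
  refine AdicCompletion.ext fun n => ?_
  obtain ⟨m, x, y, hxy⟩ := B.exists_approx n (B.comul u)
  have h1 := B.comul_mul u v n m 1 x y (fun _ => p) (fun _ => q) hxy
    (by simp [AeRing.Approx, AeRing.sumMod, h])
  rw [AdicCompletion.map_val_apply, ← AdicCompletion.eval_apply, ← AdicCompletion.eval_apply, h1,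
    hxy]
  simp [AeRing.sumMod, B.rmul_tens]

theorem map_rmul_rmul (a b c d : U) (w : AdicCompletion I B.Tens) :
    AdicCompletion.map I (B.rmul a b) (AdicCompletion.map I (B.rmul c d) w) =
      AdicCompletion.map I (B.rmul (c * a) (d * b)) w := by
  rw [AdicCompletion.map_comp_apply]
  congr 1
  congr 1
  refine BalTensor.hom_ext fun u v => ?_
  rw [LinearMap.comp_apply, B.rmul_tens, B.rmul_tens, B.rmul_tens, mul_assoc, mul_assoc]

/-- The Hopf-Galois map `u ⊗ v ↦ u₁ ⊗ u₂ v` before completion of its source. -/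
noncomputable def galoisLAux : B.TensL →ₗ[R] AdicCompletion I B.Tens :=
  BalTensor.lift
    (LinearMap.mk₂ R (fun u v => AdicCompletion.map I (B.rmul 1 v) (B.comul u))
      (fun u u' v => by rw [map_add, map_add])
      (fun c u v => by
        rw [map_smul]
        exact LinearMap.map_smul_of_tower (AdicCompletion.map I (B.rmul 1 v)) c (B.comul u))
      (fun u v v' => by
        rw [← adicMap_add]
        congr 2
        refine BalTensor.hom_ext fun x y => ?_
        rw [LinearMap.add_apply, B.rmul_tens, B.rmul_tens, B.rmul_tens, mul_add]
        exact map_add (BalTensor.mk _ _ _) _ _)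
      (fun c u v => by
        rw [← adicMap_smul]
        congr 2
        refine BalTensor.hom_ext fun x y => ?_
        rw [LinearMap.smul_apply, B.rmul_tens, B.rmul_tens, mul_smul_comm]
        exact map_smul (BalTensor.mk _ _ _) _ _))
    (fun a u v => by
      simp only [LinearMap.mk₂_apply, LinearMap.mulRight_apply, LinearMap.mulLeft_apply]
      rw [B.comul_mul_of u _ _ _ (B.comul_t a), B.map_rmul_rmul, one_mul])

/-- The Hopf-Galois map `u ⊗ v ↦ u₁ v ⊗ u₂` before completion of its source. -/
noncomputable def galoisRAux : B.TensR →ₗ[R] AdicCompletion I B.Tens :=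
  BalTensor.lift
    (LinearMap.mk₂ R (fun u v => AdicCompletion.map I (B.rmul v 1) (B.comul u))
      (fun u u' v => by rw [map_add, map_add])
      (fun c u v => by
        rw [map_smul]
        exact LinearMap.map_smul_of_tower (AdicCompletion.map I (B.rmul v 1)) c (B.comul u))
      (fun u v v' => by
        rw [← adicMap_add]
        congr 2
        refine BalTensor.hom_ext fun x y => ?_
        rw [LinearMap.add_apply, B.rmul_tens, B.rmul_tens, B.rmul_tens, mul_add]
        exact LinearMap.map_add₂ (BalTensor.mk _ _) _ _ _)
      (fun c u v => by
        rw [← adicMap_smul]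
        congr 2
        refine BalTensor.hom_ext fun x y => ?_
        rw [LinearMap.smul_apply, B.rmul_tens, B.rmul_tens, mul_smul_comm]
        exact LinearMap.map_smul₂ (BalTensor.mk _ _) _ _ _))
    (fun a u v => by
      simp only [LinearMap.mk₂_apply, LinearMap.mulRight_apply, LinearMap.mulLeft_apply]
      rw [B.comul_mul_of u _ _ _ (B.comul_s a), B.map_rmul_rmul, one_mul])

/-- The Hopf-Galois map `α_ℓ : ▸U ⊗^_{Aᵒᵖ} U_◁ → U_◁ ⊗^_A ▷U`, `u ⊗ v ↦ u₁ ⊗ u₂ v`. -/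
noncomputable def galoisL : AdicCompletion I B.TensL →ₗ[R] AdicCompletion I B.Tens :=
  hatExtend I B.galoisLAux

/-- The Hopf-Galois map `α_r : U_◂ ⊗^^A ▷U → U_◁ ⊗^_A ▷U`, `u ⊗ v ↦ u₁ v ⊗ u₂`. -/
noncomputable def galoisR : AdicCompletion I B.TensR →ₗ[R] AdicCompletion I B.Tens :=
  hatExtend I B.galoisRAux

/-- `U` is a left Hopf algebroid. -/
def IsLeftHopf : Prop := Function.Bijective B.galoisL

/-- `U` is a right Hopf algebroid. -/
def IsRightHopf : Prop := Function.Bijective B.galoisR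

variable {B}

/-- The left translation map `u ↦ u₊ ⊗ u₋ = α_ℓ⁻¹(u ⊗ 1)`. -/
noncomputable def translL (hB : B.IsLeftHopf) (u : U) : AdicCompletion I B.TensL :=
  (LinearEquiv.ofBijective B.galoisL hB).symm (AdicCompletion.of I _ (B.tens u 1))

/-- The right translation map `u ↦ u₍₊₎ ⊗ u₍₋₎ = α_r⁻¹(1 ⊗ u)`. -/
noncomputable def translR (hB : B.IsRightHopf) (u : U) : AdicCompletion I B.TensR :=
  (LinearEquiv.ofBijective B.galoisR hB).symm (AdicCompletion.of I _ (B.tens 1 u))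

end LeftBialgebroid

/-! ## Quantisations -/

/-- The ideal `(h)` of `k[[h]]`. -/
noncomputable abbrev hIdeal (k : Type*) [CommRing k] : Ideal (PowerSeries k) :=
  Ideal.span {(PowerSeries.X : PowerSeries k)}

/-- `(U_h, A_h)` is a quantisation of the left bialgebroid `(U, A)` over `k`: isomorphisms of
`k[[h]]`-modules `A_h ≅ A[[h]]` and `U_h ≅ U[[h]]` (a series `∑ vₙ hⁿ` being the sequence of its
coefficients) which modulo `h` become an isomorphism of left bialgebroids
`(U_h / h U_h, A_h / h A_h) ≅ (U, A)`. -/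
structure Quantisation {k A U Ah Uh : Type*} [CommRing k] [Ring A] [Algebra k A] [Ring U]
    [Algebra k U] [Ring Ah] [Algebra (PowerSeries k) Ah] [Ring Uh] [Algebra (PowerSeries k) Uh]
    (B : LeftBialgebroid (⊥ : Ideal k) A U) (Bh : LeftBialgebroid (hIdeal k) Ah Uh) where
  /-- the isomorphism `A_h ≅ A[[h]]` -/
  eA : Ah ≃+ (ℕ → A)
  eA_smul : ∀ (f : PowerSeries k) (a : Ah) (n : ℕ),
    eA (f • a) n = ∑ p ∈ Finset.HasAntidiagonal.antidiagonal n, PowerSeries.coeff p.1 f • eA a p.2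
  /-- the isomorphism `U_h ≅ U[[h]]` -/
  eU : Uh ≃+ (ℕ → U)
  eU_smul : ∀ (f : PowerSeries k) (u : Uh) (n : ℕ),
    eU (f • u) n = ∑ p ∈ Finset.HasAntidiagonal.antidiagonal n, PowerSeries.coeff p.1 f • eU u p.2
  base_one : eA 1 0 = 1
  base_mul : ∀ a b : Ah, eA (a * b) 0 = eA a 0 * eA b 0
  total_one : eU 1 0 = 1
  total_mul : ∀ u v : Uh, eU (u * v) 0 = eU u 0 * eU v 0
  source : ∀ a : Ah, eU (Bh.s a) 0 = B.s (eA a 0)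
  target : ∀ a : Ah, eU (Bh.tgt a) 0 = B.tgt (eA a 0)
  counit : ∀ u : Uh, eA (Bh.counit u) 0 = B.counit (eU u 0)
  comul : ∀ (u : Uh) (m : ℕ) (x y : Fin m → Uh), Bh.Approx (hIdeal k) 1 (Bh.comul u) x y →
    B.comul (eU u 0) = AdicCompletion.of ⊥ _ (∑ i, B.tens (eU (x i) 0) (eU (y i) 0))

/-! ## Left and right modules -/

namespace AeRing

variable {R A U : Type*} [CommRing R] [Ring A] [Algebra R A] [Ring U] [Algebra R U]
  (E : AeRing R A U)

/-- For a right `U`-module `P`, the right `A`-module `P_◂`, `p ◂ a = p s(a)`, is finitely generated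
projective over `Aᵒᵖ`. -/
def IsFGProjectiveRight (P : Type*) [AddCommGroup P] [Module Uᵐᵒᵖ P] : Prop :=
  letI : Module Aᵐᵒᵖ P := Module.compHom P (AlgHom.op E.s).toRingHom
  Module.Finite Aᵐᵒᵖ P ∧ Module.Projective Aᵐᵒᵖ P

/-- For a right `U`-module `P`, the left `A`-module `▸P`, `a ▸ p = p t(a)`, is finitely generated
projective over `A`. -/
def IsFGProjectiveLeft (P : Type*) [AddCommGroup P] [Module Uᵐᵒᵖ P] : Prop :=
  letI : Module A P := Module.compHom P E.t.toRingHom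
  Module.Finite A P ∧ Module.Projective A P

variable (P N M : Type*)
  [AddCommGroup P] [Module R P] [Module Uᵐᵒᵖ P] [IsScalarTower R Uᵐᵒᵖ P]
  [AddCommGroup N] [Module R N] [Module Uᵐᵒᵖ N] [IsScalarTower R Uᵐᵒᵖ N]
  [AddCommGroup M] [Module R M] [Module U M] [IsScalarTower R U M]

/-- `Hom_{Aᵒᵖ}(P, N) = Hom_{Aᵒᵖ}(P_◂, N_◂)` for right `U`-modules `P` and `N`. -/
def homA : Submodule R (P →ₗ[R] N) where
  carrier := {φ | ∀ (a : A) (p : P), φ (op (E.s a) • p) = op (E.s a) • φ p}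
  add_mem' hφ hψ a p := by simp [hφ a p, hψ a p]
  zero_mem' a p := by simp
  smul_mem' c φ hφ a p := by
    rw [LinearMap.smul_apply, LinearMap.smul_apply, hφ a p, ← algebraMap_smul Uᵐᵒᵖ c,
      ← algebraMap_smul Uᵐᵒᵖ c, smul_smul, smul_smul, Algebra.commutes]

variable {P N M}

/-- `p ↦ a ▸ p = p t(a)`, as an element of `Hom_{Aᵒᵖ}(P, P)`. -/
def blact (a : A) : E.homA P P :=
  ⟨Algebra.lsmul R R P (op (E.tgt a)), fun b p => by
    simp only [Algebra.lsmul_coe, smul_smul, ← MulOpposite.op_mul]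
    rw [tgt, E.comm]⟩

variable (P N M)

/-- `▸P ⊗_{Aᵒᵖ} M_◁` for a right `U`-module `P` and a left `U`-module `M`: the tensor product with
relations `p t(a) ⊗ m = p ⊗ t(a) m`. -/
abbrev tensorA : Type _ :=
  BalTensor (fun a : A => Algebra.lsmul R R P (op (E.tgt a)))
    (fun a : A => Algebra.lsmul R R M (E.tgt a))

variable {P N M}

/-- The class of `p ⊗ m` in `▸P ⊗_{Aᵒᵖ} M_◁`. -/
abbrev tensorAMk (p : P) (m : M) : E.tensorA P M :=
  BalTensor.tmul (fun a : A => Algebra.lsmul R R P (op (E.tgt a)))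
    (fun a : A => Algebra.lsmul R R M (E.tgt a)) p m

/-- The operator `φ ↦ φ ◁ a = (p ↦ φ(p t(a)))` on `Hom_{Aᵒᵖ}(P, N)`. -/
def homRact (a : A) : Module.End R (E.homA P N) where
  toFun φ := ⟨φ.1 ∘ₗ (E.blact a : E.homA P P).1, fun b p => by
    simp only [LinearMap.comp_apply]
    rw [(E.blact a : E.homA P P).2, φ.2]⟩
  map_add' _ _ := rfl
  map_smul' _ _ := rfl

variable (P N)

/-- `▸P ⊗_{Aᵒᵖ} Hom_{Aᵒᵖ}(P, N)_◁`. -/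
abbrev tensorHom : Type _ :=
  BalTensor (fun a : A => Algebra.lsmul R R P (op (E.tgt a)))
    (fun a : A => (E.homRact a : Module.End R (E.homA P N)))

/-- The evaluation map `▸P ⊗_{Aᵒᵖ} Hom_{Aᵒᵖ}(P, N)_◁ → N`, `p ⊗ φ ↦ φ(p)`. -/
def evalMap : E.tensorHom P N →ₗ[R] N :=
  BalTensor.lift (LinearMap.flip (E.homA P N).subtype) (fun _ _ _ => rfl)

variable {P N}

/-- For `p ∈ P` and `m ∈ M`, the map `x ⊗ y ↦ p x ⊗ y m`. -/
noncomputable def tensorAct (p : P) (m : M) : E.TensL →ₗ[R] E.tensorA P M :=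
  BalTensor.lift
    (LinearMap.mk₂ R (fun x y => E.tensorAMk (op x • p) (y • m))
      (fun x x' y => by
        rw [MulOpposite.op_add, add_smul]
        exact LinearMap.map_add₂ (BalTensor.mk _ _) _ _ _)
      (fun c x y => by
        rw [op_smul, smul_assoc]
        exact LinearMap.map_smul₂ (BalTensor.mk _ _) _ _ _)
      (fun x y y' => by
        rw [add_smul]
        exact map_add (BalTensor.mk _ _ _) _ _)
      (fun c x y => by
        rw [smul_assoc]
        exact map_smul (BalTensor.mk _ _ _) _ _))
    (fun a x y => by
      simp only [LinearMap.mk₂_apply, LinearMap.mulRight_apply, LinearMap.mulLeft_apply,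
        MulOpposite.op_mul, mul_smul]
      exact BalTensor.tmul_eq (fun a : A => Algebra.lsmul R R P (op (E.tgt a)))
        (fun a : A => Algebra.lsmul R R M (E.tgt a)) a (op x • p) (y • m))

/-- For `φ ∈ Hom_{Aᵒᵖ}(P, N)` and `p ∈ P`, the map `x ⊗ y ↦ φ(p x) y`. -/
noncomputable def homAct (φ : E.homA P N) (p : P) : E.TensR →ₗ[R] N :=
  BalTensor.lift
    (LinearMap.mk₂ R (fun x y => op y • φ.1 (op x • p))
      (fun x x' y => by simp only [MulOpposite.op_add, add_smul, map_add, smul_add])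
      (fun c x y => by
        rw [op_smul, smul_assoc, map_smul, ← algebraMap_smul Uᵐᵒᵖ c, ← algebraMap_smul Uᵐᵒᵖ c,
          smul_smul, smul_smul, Algebra.commutes])
      (fun x y y' => by simp only [MulOpposite.op_add, add_smul])
      (fun c x y => by rw [op_smul, smul_assoc]))
    (fun a x y => by
      simp only [LinearMap.mk₂_apply, LinearMap.mulRight_apply, LinearMap.mulLeft_apply,
        MulOpposite.op_mul, mul_smul]
      rw [φ.2])

end AeRing

/-! ## Complete modules -/

section Modules

/-- A module over an `R`-algebra is an `R`-module. -/
@[reducible]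
instance moduleOfAlgebra {R B : Type*} [CommRing R] [Ring B] [Algebra R B] (M : ModuleCat.{v} B) :
    Module R M :=
  Module.compHom M (algebraMap R B)

instance isScalarTowerOfAlgebra {R B : Type*} [CommRing R] [Ring B] [Algebra R B]
    (M : ModuleCat.{v} B) : IsScalarTower R B M :=
  ⟨fun c b m => by
    rw [Algebra.smul_def, mul_smul]
    rfl⟩

/-- The `B`-modules which are (separated and) complete for the `I`-adic topology. -/
def isCompleteModule {R : Type*} [CommRing R] (I : Ideal R) (B : Type*) [Ring B] [Algebra R B] :
    ObjectProperty (ModuleCat.{v} B) :=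
  fun M => IsAdicComplete I M

/-- The category of complete left `U`-modules. -/
abbrev CompleteLeft {R : Type*} [CommRing R] (I : Ideal R) (U : Type*) [Ring U] [Algebra R U] :
    Type _ :=
  (isCompleteModule.{v} I U).FullSubcategory

/-- The category of complete right `U`-modules. -/
abbrev CompleteRight {R : Type*} [CommRing R] (I : Ideal R) (U : Type*) [Ring U] [Algebra R U] :
    Type _ :=
  (isCompleteModule.{v} I Uᵐᵒᵖ).FullSubcategory

variable {R : Type*} [CommRing R] {I : Ideal R} {A U : Type*} [Ring A] [Algebra R A] [Ring U]
  [Algebra R U] {B : LeftBialgebroid I A U}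

/-- `F` is the functor `M ↦ ▸P ⊗_{Aᵒᵖ} M_◁`: the module `F(M)` is `▸P ⊗_{Aᵒᵖ} M_◁` with the right
`U`-action `(p ⊗ m) u = p u₊ ⊗ u₋ m` (a limit, expressed in the completion), and `F(f)` is
`p ⊗ m ↦ p ⊗ f(m)`. -/
def IsTensorFunctor (hB : B.IsLeftHopf) (P : ModuleCat.{v} Uᵐᵒᵖ)
    (F : CompleteLeft.{v} I U ⥤ CompleteRight.{v} I U) : Prop :=
  ∃ θ : ∀ M : CompleteLeft.{v} I U, (F.obj M).obj ≃ₗ[R] B.tensorA P M.obj,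
    (∀ (M : CompleteLeft.{v} I U) (p : P) (m : M.obj) (u : U),
      AdicCompletion.of I _ (θ M (op u • (θ M).symm (B.tensorAMk p m))) =
        AdicCompletion.map I (B.tensorAct p m) (LeftBialgebroid.translL hB u)) ∧
    ∀ (M M' : CompleteLeft.{v} I U) (f : M ⟶ M') (p : P) (m : M.obj),
      θ M' ((F.map f).hom ((θ M).symm (B.tensorAMk p m))) = B.tensorAMk p (f.hom m)

/-- `G` is the functor `N ↦ Hom_{Aᵒᵖ}(P, N)`: the module `G(N)` is `Hom_{Aᵒᵖ}(P, N)` with the left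
`U`-action `(u φ)(p) = φ(p u₍₊₎) u₍₋₎` (a limit, expressed in the completion), and `G(f)` is
`φ ↦ f ∘ φ`. -/
def IsHomFunctor (hB : B.IsRightHopf) (P : ModuleCat.{v} Uᵐᵒᵖ)
    (G : CompleteRight.{v} I U ⥤ CompleteLeft.{v} I U) : Prop :=
  ∃ θ : ∀ N : CompleteRight.{v} I U, (G.obj N).obj ≃ₗ[R] B.homA P N.obj,
    (∀ (N : CompleteRight.{v} I U) (φ : B.homA P N.obj) (p : P) (u : U),
      AdicCompletion.of I _ ((θ N (u • (θ N).symm φ)).1 p) =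
        AdicCompletion.map I (B.homAct φ p) (LeftBialgebroid.translR hB u)) ∧
    ∀ (N N' : CompleteRight.{v} I U) (f : N ⟶ N') (φ : B.homA P N.obj) (p : P),
      (θ N' ((G.map f).hom ((θ N).symm φ))).1 p = f.hom (φ.1 p)

end Modules

end HopfAlgd

open HopfAlgd

/-! The two functors form the tensor–Hom pair attached to `P` over Aᵒᵖ, with unit m ↦ (p ↦ p ⊗ m)
and counit p ⊗ φ ↦ φ(p). What must be shown is that the `U`-actions exist, that unit and counit are
`U`-linear, and that both are bijective. The argument works for any finitely generated ideal `I` of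
a commutative ring `R`.

Identities for the translation maps are proved by applying an injective Hopf–Galois map. The rule
α_ℓ(x u₊ ⊗ u₋ y) = x₁ u ⊗ x₂ y (`galoisL_outerMul_translL`) and its mirror
`galoisR_outerMul_translR` reduce them to properties of the coproduct. They give `translL_balanced`
and `translL_mul` with their right-hand versions, hence the two module structures, and the mixed
identities `splitL_translR` and `splitR_translL`, which are what linearity of unit and counit
amounts to. It suffices to compare maps on pure tensors, since for finitely generated `I` linear
maps from a completion to a separated module are determined on the image of the original module
(`adic_hom_ext`).

Dual bases make P ⊗ M and Hom(P, N) retracts of finite powers of M and N, so they are already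
complete and the limits defining the actions exist in them. The counit is bijective by the
evaluation hypothesis. For the unit, projectivity and A ≅ Hom(P, P) give Hom(P, P ⊗ M) ≅ Hom(P, P) ⊗
M ≅ M; `unitMap_bijective` writes down the inverse. -/

namespace HopfAlgd

/-! ### Linear maps on adic completions, and complete modules -/

section AdicExtension

variable {R : Type*} [CommRing R] {I : Ideal R} {S T Q Q' : Type*}
  [AddCommGroup S] [Module R S] [AddCommGroup T] [Module R T] [AddCommGroup Q] [Module R Q]
  [AddCommGroup Q'] [Module R Q']

theorem map_pow_smul_top_le (φ : T →ₗ[R] Q) (n : ℕ) :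
    (I ^ n • ⊤ : Submodule R T).map φ ≤ (I ^ n • ⊤ : Submodule R Q) :=
  (Submodule.map_smul'' (I ^ n) ⊤ φ).le.trans (Submodule.smul_mono le_rfl le_top)

/-- Density of T in its completion: finite generation of `I` identifies the kernel of evaluation at
level n with `I ^ n` times the completion, so agreement modulo `I ^ n` becomes a statement that
every linear map preserves. -/
theorem sub_of_mem_pow_smul_top (hI : I.FG) {n : ℕ} {w : AdicCompletion I T} {x : T}
    (hx : AdicCompletion.eval I T n w = Submodule.mkQ _ x) :
    w - AdicCompletion.of I T x ∈ (I ^ n • ⊤ : Submodule R (AdicCompletion I T)) := by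
  rw [AdicCompletion.pow_smul_top_eq_ker_eval hI, LinearMap.mem_ker, map_sub,
    AdicCompletion.eval_of, hx, sub_self]

/-- For finitely generated `I`, linear maps from a completion to a separated module are determined
by their values on the image of the original module. -/
theorem adic_hom_ext (hI : I.FG) [IsHausdorff I Q] {φ ψ : AdicCompletion I T →ₗ[R] Q}
    (h : ∀ x, φ (AdicCompletion.of I T x) = ψ (AdicCompletion.of I T x)) : φ = ψ := by
  refine LinearMap.ext fun w => IsHausdorff.eq_iff_smodEq (I := I) |>.2 fun n => ?_
  obtain ⟨t, ht⟩ := Submodule.mkQ_surjective _ (AdicCompletion.eval I T n w)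
  -- The maps agree on the approximation t, so their difference at w is its value at w - t, which
  -- lies in `I ^ n` times the completion; separatedness concludes as n varies.
  have key : φ w - ψ w = (φ - ψ) (w - AdicCompletion.of I T t) := by
    simp [h t]
  rw [SModEq.sub_mem, key]
  exact map_pow_smul_top_le _ n (Submodule.mem_map_of_mem (sub_of_mem_pow_smul_top hI ht.symm))

theorem adic_balTensor_hom_ext (hI : I.FG) {A : Type*} {f : A → Module.End R S}
    {g : A → Module.End R T} [IsHausdorff I Q]
    {φ ψ : AdicCompletion I (BalTensor f g) →ₗ[R] Q}
    (h : ∀ x y, φ (AdicCompletion.of I _ (BalTensor.tmul f g x y)) =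
      ψ (AdicCompletion.of I _ (BalTensor.tmul f g x y))) : φ = ψ := by
  refine adic_hom_ext hI fun z => ?_
  have : φ ∘ₗ AdicCompletion.of I _ = ψ ∘ₗ AdicCompletion.of I _ := BalTensor.hom_ext h
  exact LinearMap.congr_fun this z

variable (I) in
/-- The completion of a linear map, as an `R`-linear map. -/
noncomputable def adicMap (f : T →ₗ[R] S) : AdicCompletion I T →ₗ[R] AdicCompletion I S where
  toFun := AdicCompletion.map I f
  map_add' := map_add _
  map_smul' c := LinearMap.map_smul_of_tower (AdicCompletion.map I f) c

theorem adicMap_apply (f : T →ₗ[R] S) (w : AdicCompletion I T) :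
    adicMap I f w = AdicCompletion.map I f w := rfl

@[simp]
theorem adicMap_of (f : T →ₗ[R] S) (x : T) :
    adicMap I f (AdicCompletion.of I T x) = AdicCompletion.of I S (f x) :=
  AdicCompletion.map_of I f x

/-- Modulo `I ^ n` the extension may be computed on any representative, because it is linear and
hence preserves `I ^ n` multiples. -/
theorem eval_hatExtend (hI : I.FG) (g : T →ₗ[R] AdicCompletion I S) (n : ℕ)
    (w : AdicCompletion I T) (x : T) (hx : AdicCompletion.eval I T n w = Submodule.mkQ _ x) :
    AdicCompletion.eval I S n (hatExtend I g w) = AdicCompletion.eval I S n (g x) := by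
  rw [← hatExtend_of I g x, ← sub_eq_zero, ← map_sub, ← map_sub, ← LinearMap.mem_ker]
  refine AdicCompletion.pow_smul_top_le_ker_eval (M := S) I n
    (map_pow_smul_top_le (hatExtend I g) n ?_)
  exact Submodule.mem_map_of_mem (sub_of_mem_pow_smul_top hI hx)

variable (I) in
/-- The extension to the completion of a linear map with values in a complete module. -/
noncomputable def adicExtend [IsAdicComplete I Q] (g : T →ₗ[R] Q) : AdicCompletion I T →ₗ[R] Q :=
  (AdicCompletion.ofLinearEquiv I Q).symm.toLinearMap ∘ₗ adicMap I g

@[simp]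
theorem adicExtend_of [IsAdicComplete I Q] (g : T →ₗ[R] Q) (x : T) :
    adicExtend I g (AdicCompletion.of I T x) = g x := by
  simp [adicExtend]

/-- Translates the limits taken inside a complete module into the form used in `IsTensorFunctor` and
`IsHomFunctor`. -/
theorem of_adicExtend [IsAdicComplete I Q] (g : T →ₗ[R] Q) (w : AdicCompletion I T) :
    AdicCompletion.of I Q (adicExtend I g w) = AdicCompletion.map I g w := by
  simp [adicExtend, adicMap_apply]

theorem adicExtend_add (hI : I.FG) [IsAdicComplete I Q] (g g' : T →ₗ[R] Q) :
    adicExtend I (g + g') = adicExtend I g + adicExtend I g' :=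
  adic_hom_ext hI fun x => by simp

theorem adicExtend_smul (hI : I.FG) [IsAdicComplete I Q] (c : R) (g : T →ₗ[R] Q) :
    adicExtend I (c • g) = c • adicExtend I g :=
  adic_hom_ext hI fun x => by simp

/-- A retract of a complete module is complete. -/
theorem isAdicComplete_of_retract [IsAdicComplete I Q'] (i : Q →ₗ[R] Q') (r : Q' →ₗ[R] Q)
    (hri : ∀ x, r (i x) = x) : IsAdicComplete I Q := by
  refine AdicCompletion.of_bijective_iff.1 ⟨?_, fun w => ?_⟩
  · refine (injective_iff_map_eq_zero _).2 fun x hx => ?_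
    have h : AdicCompletion.of I Q' (i x) = 0 := by
      rw [← AdicCompletion.map_of, hx, map_zero]
    rw [(injective_iff_map_eq_zero _).1 (AdicCompletion.of_injective I Q') _ h |>
      fun h' : i x = 0 => (hri x).symm.trans (congrArg r h'), map_zero]
  -- The completion of i sends w into the completion of Q', which is Q' itself; applying r to the
  -- resulting y recovers w, since the completion of r ∘ i is the identity.
  · obtain ⟨y, hy⟩ := AdicCompletion.of_surjective I Q' (AdicCompletion.map I i w)
    refine ⟨r y, ?_⟩
    rw [← AdicCompletion.map_of, hy, AdicCompletion.map_comp_apply,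
      show r ∘ₗ i = LinearMap.id from LinearMap.ext hri, AdicCompletion.map_id]
    rfl

theorem isAdicComplete_pi (hI : I.FG) [IsAdicComplete I Q] (n : ℕ) :
    IsAdicComplete I (Fin n → Q) := by
  have := AdicCompletion.isAdicComplete (M := Fin n → Q) hI
  -- The power embeds in its own completion, which is complete as `I` is finitely generated; the
  -- coordinate projections extend to it because Q is complete, and together they give the
  -- retraction.
  refine isAdicComplete_of_retract (AdicCompletion.of I (Fin n → Q))
    (LinearMap.pi fun i => adicExtend I (LinearMap.proj i)) fun x => ?_
  funext i
  simp

end AdicExtension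

/-! ### Multiplication operators on the balanced tensor squares of `U` -/

namespace AeRing

variable {R A U : Type*} [CommRing R] [Ring A] [Algebra R A] [Ring U] [Algebra R U]
  (E : AeRing R A U)

@[simp]
theorem tgt_one : E.tgt 1 = 1 := by simp [tgt]

theorem tgt_mul (a b : A) : E.tgt (a * b) = E.tgt b * E.tgt a := by simp [tgt]

@[simp]
theorem tgt_add (a b : A) : E.tgt (a + b) = E.tgt a + E.tgt b := by simp [tgt]

@[simp]
theorem tgt_smul (c : R) (a : A) : E.tgt (c • a) = c • E.tgt a := by simp [tgt]

theorem s_tgt (a b : A) : E.s a * E.tgt b = E.tgt b * E.s a := E.comm a b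

theorem rmul_add_left (a a' b : U) : E.rmul (a + a') b = E.rmul a b + E.rmul a' b :=
  BalTensor.hom_ext fun u v => by
    rw [LinearMap.add_apply, E.rmul_tens, E.rmul_tens, E.rmul_tens, mul_add]
    exact LinearMap.map_add₂ (BalTensor.mk _ _) _ _ _

theorem rmul_add_right (a b b' : U) : E.rmul a (b + b') = E.rmul a b + E.rmul a b' :=
  BalTensor.hom_ext fun u v => by
    rw [LinearMap.add_apply, E.rmul_tens, E.rmul_tens, E.rmul_tens, mul_add]
    exact map_add (BalTensor.mk _ _ _) _ _

theorem rmul_smul_left (c : R) (a b : U) : E.rmul (c • a) b = c • E.rmul a b :=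
  BalTensor.hom_ext fun u v => by
    rw [LinearMap.smul_apply, E.rmul_tens, E.rmul_tens, mul_smul_comm]
    exact LinearMap.map_smul₂ (BalTensor.mk _ _) _ _ _

theorem rmul_smul_right (c : R) (a b : U) : E.rmul a (c • b) = c • E.rmul a b :=
  BalTensor.hom_ext fun u v => by
    rw [LinearMap.smul_apply, E.rmul_tens, E.rmul_tens, mul_smul_comm]
    exact map_smul (BalTensor.mk _ _ _) _ _

end AeRing

/-- The tensor product of `U` with itself, with relations `u f(a) ⊗ v = u ⊗ f(a)v`. -/
abbrev InnerTensor (R : Type*) {A U : Type*} [CommRing R] [Ring U] [Algebra R U] (f : A → U) :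
    Type _ :=
  BalTensor (fun a => LinearMap.mulRight R (f a)) (fun a => LinearMap.mulLeft R (f a))

namespace InnerTensor

variable {R : Type*} {A U : Type*} [CommRing R] [Ring U] [Algebra R U] (f : A → U)

variable (R) in
/-- The class of `u ⊗ v`. -/
abbrev tmul (u v : U) : InnerTensor R f :=
  BalTensor.tmul (fun a => LinearMap.mulRight R (f a)) (fun a => LinearMap.mulLeft R (f a)) u v

variable (R) in
/-- The map `p ⊗ q ↦ x p ⊗ q y`. -/
noncomputable def outerMul (x y : U) : InnerTensor R f →ₗ[R] InnerTensor R f :=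
  BalTensor.lift
    (LinearMap.compl₁₂ (BalTensor.mk (fun a => LinearMap.mulRight R (f a))
        (fun a => LinearMap.mulLeft R (f a))) (LinearMap.mulLeft R x) (LinearMap.mulRight R y))
    (fun c u v => by
      simp only [LinearMap.compl₁₂_apply, BalTensor.mk_apply, LinearMap.mulRight_apply,
        LinearMap.mulLeft_apply, mul_assoc]
      rw [← mul_assoc]
      exact BalTensor.tmul_eq (fun a => LinearMap.mulRight R (f a))
        (fun a => LinearMap.mulLeft R (f a)) c (x * u) (v * y))

@[simp]
theorem outerMul_tmul (x y u v : U) :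
    outerMul R f x y (tmul R f u v) = tmul R f (x * u) (v * y) :=
  BalTensor.lift_tmul _ _ u v

theorem outerMul_add_left (x x' y : U) :
    outerMul R f (x + x') y = outerMul R f x y + outerMul R f x' y :=
  BalTensor.hom_ext fun u v => by
    rw [LinearMap.add_apply, outerMul_tmul, outerMul_tmul, outerMul_tmul, add_mul]
    exact LinearMap.map_add₂ (BalTensor.mk _ _) _ _ _

theorem outerMul_add_right (x y y' : U) :
    outerMul R f x (y + y') = outerMul R f x y + outerMul R f x y' :=
  BalTensor.hom_ext fun u v => by
    rw [LinearMap.add_apply, outerMul_tmul, outerMul_tmul, outerMul_tmul, mul_add]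
    exact map_add (BalTensor.mk _ _ _) _ _

theorem outerMul_smul_left (c : R) (x y : U) :
    outerMul R f (c • x) y = c • outerMul R f x y :=
  BalTensor.hom_ext fun u v => by
    rw [LinearMap.smul_apply, outerMul_tmul, outerMul_tmul, smul_mul_assoc]
    exact LinearMap.map_smul₂ (BalTensor.mk _ _) _ _ _

theorem outerMul_smul_right (c : R) (x y : U) :
    outerMul R f x (c • y) = c • outerMul R f x y :=
  BalTensor.hom_ext fun u v => by
    rw [LinearMap.smul_apply, outerMul_tmul, outerMul_tmul, mul_smul_comm]
    exact map_smul (BalTensor.mk _ _ _) _ _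

end InnerTensor

/-! ### Hopf–Galois maps and the translation maps -/

namespace LeftBialgebroid

variable {R : Type*} [CommRing R] {I : Ideal R} {A U : Type*} [Ring A] [Algebra R A] [Ring U]
  [Algebra R U] (B : LeftBialgebroid I A U)

/-- The map `p ⊗ q ↦ x₁ p ⊗ x₂ q`, before completion of its source. -/
noncomputable def comulMulAux (x : U) : B.Tens →ₗ[R] AdicCompletion I B.Tens :=
  BalTensor.lift
    (LinearMap.mk₂ R (fun p q => AdicCompletion.map I (B.rmul p q) (B.comul x))
      (fun p p' q => by rw [B.rmul_add_left, adicMap_add])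
      (fun c p q => by rw [B.rmul_smul_left, adicMap_smul])
      (fun p q q' => by rw [B.rmul_add_right, adicMap_add])
      (fun c p q => by rw [B.rmul_smul_right, adicMap_smul]))
    -- Balancedness is the Takeuchi condition for x, multiplied on the right by p ⊗ q.
    (fun a p q => by
      have h := congrArg (AdicCompletion.map I (B.rmul p q)) (B.comul_takeuchi a x)
      rw [B.map_rmul_rmul, B.map_rmul_rmul, one_mul, one_mul] at h
      exact h)

/-- The map `p ⊗ q ↦ x₁ p ⊗ x₂ q`. -/
noncomputable def comulMul (x : U) : AdicCompletion I B.Tens →ₗ[R] AdicCompletion I B.Tens :=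
  hatExtend I (B.comulMulAux x)

@[simp]
theorem comulMul_of (x p q : U) : B.comulMul x (AdicCompletion.of I _ (B.tens p q)) =
    adicMap I (B.rmul p q) (B.comul x) :=
  hatExtend_of I _ _

/-- Multiplicativity of the coproduct, freed from the choice of representatives modulo `I ^ n`. -/
theorem comulMul_comul (hI : I.FG) (x p : U) : B.comulMul x (B.comul p) = B.comul (x * p) := by
  refine AdicCompletion.ext fun n => ?_
  obtain ⟨m, a, b, hab⟩ := B.exists_approx n (B.comul x)
  obtain ⟨l, c, d, hcd⟩ := B.exists_approx n (B.comul p)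
  rw [← AdicCompletion.eval_apply, ← AdicCompletion.eval_apply,
    B.comul_mul x p n m l a b c d hab hcd, comulMul, eval_hatExtend hI _ n _ _ hcd, map_sum, map_sum,
    Finset.sum_comm, map_sum]
  refine Finset.sum_congr rfl fun j _ => ?_
  change AdicCompletion.eval I _ n (AdicCompletion.map I (B.rmul (c j) (d j)) (B.comul x)) = _
  rw [AdicCompletion.eval_apply, AdicCompletion.map_val_apply, ← AdicCompletion.eval_apply, hab]
  simp [AeRing.sumMod, B.rmul_tens]

theorem adicMap_rmul_rmul (a b c d : U) (w : AdicCompletion I B.Tens) :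
    adicMap I (B.rmul a b) (adicMap I (B.rmul c d) w) =
      adicMap I (B.rmul (c * a) (d * b)) w :=
  B.map_rmul_rmul a b c d w

theorem adicMap_rmul_one_one (w : AdicCompletion I B.Tens) : adicMap I (B.rmul 1 1) w = w := by
  have : B.rmul 1 1 = LinearMap.id := BalTensor.hom_ext fun u v => by
    rw [B.rmul_tens, mul_one, mul_one]; rfl
  rw [this, adicMap_apply, AdicCompletion.map_id]
  rfl

theorem comulMul_rmul (hI : I.FG) (x a b : U) (w : AdicCompletion I B.Tens) :
    B.comulMul x (adicMap I (B.rmul a b) w) = adicMap I (B.rmul a b) (B.comulMul x w) := by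
  suffices h : B.comulMul x ∘ₗ adicMap I (B.rmul a b) = adicMap I (B.rmul a b) ∘ₗ B.comulMul x from
    LinearMap.congr_fun h w
  refine adic_balTensor_hom_ext hI fun p q => ?_
  simp only [LinearMap.comp_apply, adicMap_of]
  rw [B.rmul_tens, comulMul_of, comulMul_of, adicMap_rmul_rmul]

@[simp]
theorem galoisL_of (u v : U) : B.galoisL (AdicCompletion.of I _ (B.tensL u v)) =
    adicMap I (B.rmul 1 v) (B.comul u) :=
  hatExtend_of I _ _

@[simp]
theorem galoisR_of (u v : U) : B.galoisR (AdicCompletion.of I _ (B.tensR u v)) =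
    adicMap I (B.rmul v 1) (B.comul u) :=
  hatExtend_of I _ _

/-- On p ⊗ q both sides are x₁ p₁ ⊗ x₂ p₂ q y, by multiplicativity of the coproduct. `B.TensL` and
`B.TensR` are by definition the `InnerTensor` of `B.tgt` and of `B.s`, so `outerMul` serves both
Galois maps. -/
theorem galoisL_outerMul (hI : I.FG) (x y : U) (w : AdicCompletion I B.TensL) :
    B.galoisL (adicMap I (InnerTensor.outerMul R B.tgt x y) w) =
      adicMap I (B.rmul 1 y) (B.comulMul x (B.galoisL w)) := by
  suffices h : B.galoisL ∘ₗ adicMap I (InnerTensor.outerMul R B.tgt x y) =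
      adicMap I (B.rmul 1 y) ∘ₗ B.comulMul x ∘ₗ B.galoisL from LinearMap.congr_fun h w
  refine adic_balTensor_hom_ext hI fun p q => ?_
  simp only [LinearMap.comp_apply, adicMap_of]
  rw [InnerTensor.outerMul_tmul, galoisL_of, galoisL_of, B.comulMul_rmul hI, B.comulMul_comul hI,
    adicMap_rmul_rmul, one_mul]

theorem galoisR_outerMul (hI : I.FG) (x y : U) (w : AdicCompletion I B.TensR) :
    B.galoisR (adicMap I (InnerTensor.outerMul R B.s x y) w) =
      adicMap I (B.rmul y 1) (B.comulMul x (B.galoisR w)) := by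
  suffices h : B.galoisR ∘ₗ adicMap I (InnerTensor.outerMul R B.s x y) =
      adicMap I (B.rmul y 1) ∘ₗ B.comulMul x ∘ₗ B.galoisR from LinearMap.congr_fun h w
  refine adic_balTensor_hom_ext hI fun p q => ?_
  simp only [LinearMap.comp_apply, adicMap_of]
  rw [InnerTensor.outerMul_tmul, galoisR_of, galoisR_of, B.comulMul_rmul hI, B.comulMul_comul hI,
    adicMap_rmul_rmul, one_mul]

variable {B}

theorem galoisL_translL (hB : B.IsLeftHopf) (u : U) :
    B.galoisL (translL hB u) = AdicCompletion.of I _ (B.tens u 1) :=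
  (LinearEquiv.ofBijective B.galoisL hB).apply_symm_apply _

theorem galoisR_translR (hB : B.IsRightHopf) (u : U) :
    B.galoisR (translR hB u) = AdicCompletion.of I _ (B.tens 1 u) :=
  (LinearEquiv.ofBijective B.galoisR hB).apply_symm_apply _

/-- The computing rule α_ℓ(x u₊ ⊗ u₋ y) = x₁ u ⊗ x₂ y. With injectivity of α_ℓ it removes the
translation map from the identities that follow. -/
theorem galoisL_outerMul_translL (hI : I.FG) (hB : B.IsLeftHopf) (x y u : U) :
    B.galoisL (adicMap I (InnerTensor.outerMul R B.tgt x y) (translL hB u)) =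
      adicMap I (B.rmul u y) (B.comul x) := by
  rw [B.galoisL_outerMul hI, galoisL_translL, comulMul_of, B.adicMap_rmul_rmul, mul_one, one_mul]

/-- The mirror rule α_r(x u₍₊₎ ⊗ u₍₋₎ y) = x₁ y ⊗ x₂ u. -/
theorem galoisR_outerMul_translR (hI : I.FG) (hB : B.IsRightHopf) (x y u : U) :
    B.galoisR (adicMap I (InnerTensor.outerMul R B.s x y) (translR hB u)) =
      adicMap I (B.rmul y u) (B.comul x) := by
  rw [B.galoisR_outerMul hI, galoisR_translR, comulMul_of, B.adicMap_rmul_rmul, mul_one, one_mul]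

/-- `(u + u')₊ ⊗ (u + u')₋ = u₊ ⊗ u₋ + u'₊ ⊗ u'₋` -/
theorem translL_add (hB : B.IsLeftHopf) (u u' : U) :
    translL hB (u + u') = translL hB u + translL hB u' := by
  refine hB.1 ?_
  rw [map_add, galoisL_translL, galoisL_translL, galoisL_translL, ← map_add]
  exact congrArg _ (LinearMap.map_add₂ (BalTensor.mk _ _) _ _ _)

theorem translL_smul (hB : B.IsLeftHopf) (c : R) (u : U) :
    translL hB (c • u) = c • translL hB u := by
  refine hB.1 ?_
  rw [map_smul, galoisL_translL, galoisL_translL, ← map_smul]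
  exact congrArg _ (LinearMap.map_smul₂ (BalTensor.mk _ _) _ _ _)

theorem translR_add (hB : B.IsRightHopf) (u u' : U) :
    translR hB (u + u') = translR hB u + translR hB u' := by
  refine hB.1 ?_
  rw [map_add, galoisR_translR, galoisR_translR, galoisR_translR, ← map_add]
  exact congrArg _ (map_add (BalTensor.mk _ _ _) _ _)

theorem translR_smul (hB : B.IsRightHopf) (c : R) (u : U) :
    translR hB (c • u) = c • translR hB u := by
  refine hB.1 ?_
  rw [map_smul, galoisR_translR, galoisR_translR, ← map_smul]
  exact congrArg _ (map_smul (BalTensor.mk _ _ _) _ _)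

/-- `t(a) u₊ ⊗ u₋ = u₊ ⊗ u₋ t(a)` -/
theorem translL_balanced (hI : I.FG) (hB : B.IsLeftHopf) (a : A) (u : U) :
    adicMap I (InnerTensor.outerMul R B.tgt (B.tgt a) 1) (translL hB u) =
      adicMap I (InnerTensor.outerMul R B.tgt 1 (B.tgt a)) (translL hB u) := by
  -- Both sides have image u ⊗ t(a) under α_ℓ.
  refine hB.1 ?_
  rw [galoisL_outerMul_translL hI, galoisL_outerMul_translL hI, B.comul_t, B.comul_one, adicMap_of,
    adicMap_of, B.rmul_tens, B.rmul_tens, mul_one, one_mul, one_mul]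

/-- `s(a) u₍₊₎ ⊗ u₍₋₎ = u₍₊₎ ⊗ u₍₋₎ s(a)` -/
theorem translR_balanced (hI : I.FG) (hB : B.IsRightHopf) (a : A) (u : U) :
    adicMap I (InnerTensor.outerMul R B.s (B.s a) 1) (translR hB u) =
      adicMap I (InnerTensor.outerMul R B.s 1 (B.s a)) (translR hB u) := by
  -- Both sides have image s(a) ⊗ u under α_r.
  refine hB.1 ?_
  rw [galoisR_outerMul_translR hI, galoisR_outerMul_translR hI, B.comul_s, B.comul_one, adicMap_of,
    adicMap_of, B.rmul_tens, B.rmul_tens, mul_one, one_mul, one_mul]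

/-- `s(a)₊ ⊗ s(a)₋ = s(a) ⊗ 1` -/
theorem translL_s (hB : B.IsLeftHopf) (a : A) :
    translL hB (B.s a) = AdicCompletion.of I _ (B.tensL (B.s a) 1) := by
  refine hB.1 ?_
  rw [galoisL_translL, galoisL_of, B.adicMap_rmul_one_one, B.comul_s]

/-- `t(a)₍₊₎ ⊗ t(a)₍₋₎ = t(a) ⊗ 1` -/
theorem translR_t (hB : B.IsRightHopf) (a : A) :
    translR hB (B.tgt a) = AdicCompletion.of I _ (B.tensR (B.tgt a) 1) := by
  refine hB.1 ?_
  rw [galoisR_translR, galoisR_of, B.adicMap_rmul_one_one, B.comul_t]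

end LeftBialgebroid

namespace InnerTensor

variable {R : Type*} {A U : Type*} [CommRing R] [Ring U] [Algebra R U] (f : A → U)

theorem adicMap_outerMul_outerMul (I : Ideal R) (x y x' y' : U)
    (w : AdicCompletion I (InnerTensor R f)) :
    adicMap I (outerMul R f x y) (adicMap I (outerMul R f x' y') w) =
      adicMap I (outerMul R f (x * x') (y' * y)) w := by
  rw [adicMap_apply, adicMap_apply, adicMap_apply, AdicCompletion.map_comp_apply]
  congr 2
  exact BalTensor.hom_ext fun u v => by
    rw [LinearMap.comp_apply, outerMul_tmul, outerMul_tmul, outerMul_tmul, mul_assoc, mul_assoc]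

/-- For an element `w` with `f(a) w₁ ⊗ w₂ = w₁ ⊗ w₂ f(a)`, the map `x ⊗ y ↦ x w₁ ⊗ w₂ y`. -/
noncomputable def insertMid (I : Ideal R) (w : AdicCompletion I (InnerTensor R f))
    (hw : ∀ a, adicMap I (outerMul R f (f a) 1) w = adicMap I (outerMul R f 1 (f a)) w) :
    InnerTensor R f →ₗ[R] AdicCompletion I (InnerTensor R f) :=
  BalTensor.lift
    (LinearMap.mk₂ R (fun x y => adicMap I (outerMul R f x y) w)
      (fun x x' y => by
        rw [outerMul_add_left]
        exact adicMap_add _ _ _ _)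
      (fun c x y => by
        rw [outerMul_smul_left]
        exact adicMap_smul _ _ _ _)
      (fun x y y' => by
        rw [outerMul_add_right]
        exact adicMap_add _ _ _ _)
      (fun c x y => by
        rw [outerMul_smul_right]
        exact adicMap_smul _ _ _ _))
    (fun a x y => by
      have h := congrArg (adicMap I (outerMul R f x y)) (hw a)
      rw [adicMap_outerMul_outerMul, adicMap_outerMul_outerMul, one_mul, mul_one] at h
      exact h)

@[simp]
theorem insertMid_tmul (I : Ideal R) (w : AdicCompletion I (InnerTensor R f))
    (hw : ∀ a, adicMap I (outerMul R f (f a) 1) w = adicMap I (outerMul R f 1 (f a)) w) (x y : U) :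
    insertMid f I w hw (tmul R f x y) = adicMap I (outerMul R f x y) w :=
  rfl

end InnerTensor

namespace LeftBialgebroid

variable {R : Type*} [CommRing R] {I : Ideal R} {A U : Type*} [Ring A] [Algebra R A] [Ring U]
  [Algebra R U] {B : LeftBialgebroid I A U}

/-- `(uv)₊ ⊗ (uv)₋ = u₊ v₊ ⊗ v₋ u₋` -/
theorem translL_mul (hI : I.FG) (hB : B.IsLeftHopf) (u v : U) :
    translL hB (u * v) =
      hatExtend I (InnerTensor.insertMid B.tgt I (translL hB v)
        fun a => translL_balanced hI hB a v) (translL hB u) := by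
  -- Inserting v₊ ⊗ v₋ in the middle corresponds under α_ℓ to right multiplication by v ⊗ 1: both
  -- composites send x ⊗ y to x₁ v ⊗ x₂ y. Evaluating at u₊ ⊗ u₋ gives uv ⊗ 1.
  have h : B.galoisL ∘ₗ hatExtend I (InnerTensor.insertMid B.tgt I (translL hB v)
      fun a => translL_balanced hI hB a v) = adicMap I (B.rmul v 1) ∘ₗ B.galoisL := by
    refine adic_balTensor_hom_ext hI fun x y => ?_
    simp only [LinearMap.comp_apply]
    rw [hatExtend_of, InnerTensor.insertMid_tmul, galoisL_outerMul_translL hI, galoisL_of,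
      B.adicMap_rmul_rmul, one_mul, mul_one]
  refine hB.1 ((galoisL_translL hB _).trans ?_)
  rw [← LinearMap.comp_apply, h, LinearMap.comp_apply, galoisL_translL, adicMap_of, B.rmul_tens,
    mul_one]

/-- `(uv)₍₊₎ ⊗ (uv)₍₋₎ = u₍₊₎ v₍₊₎ ⊗ v₍₋₎ u₍₋₎` -/
theorem translR_mul (hI : I.FG) (hB : B.IsRightHopf) (u v : U) :
    translR hB (u * v) =
      hatExtend I (InnerTensor.insertMid B.s I (translR hB v)
        fun a => translR_balanced hI hB a v) (translR hB u) := by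
  have h : B.galoisR ∘ₗ hatExtend I (InnerTensor.insertMid B.s I (translR hB v)
      fun a => translR_balanced hI hB a v) = adicMap I (B.rmul 1 v) ∘ₗ B.galoisR := by
    refine adic_balTensor_hom_ext hI fun x y => ?_
    simp only [LinearMap.comp_apply]
    rw [hatExtend_of, InnerTensor.insertMid_tmul, galoisR_outerMul_translR hI, galoisR_of,
      B.adicMap_rmul_rmul, one_mul, mul_one]
  refine hB.1 ((galoisR_translR hB _).trans ?_)
  rw [← LinearMap.comp_apply, h, LinearMap.comp_apply, galoisR_translR, adicMap_of, B.rmul_tens,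
    mul_one]

/-- This is what makes `splitL` respect the relations x s(a) ⊗ y = x ⊗ s(a)y of `B.TensR`. -/
theorem translL_s_mul (hI : I.FG) (hB : B.IsLeftHopf) (a : A) (v : U) :
    translL hB (B.s a * v) =
      adicMap I (InnerTensor.outerMul R B.tgt (B.s a) 1) (translL hB v) := by
  rw [translL_mul hI, translL_s, hatExtend_of, InnerTensor.insertMid_tmul]

theorem translR_t_mul (hI : I.FG) (hB : B.IsRightHopf) (a : A) (v : U) :
    translR hB (B.tgt a * v) =
      adicMap I (InnerTensor.outerMul R B.s (B.tgt a) 1) (translR hB v) := by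
  rw [translR_mul hI, translR_t, hatExtend_of, InnerTensor.insertMid_tmul]

/-- The map `x ⊗ y ↦ x y₊ ⊗ y₋`. -/
noncomputable def splitL (hI : I.FG) (hB : B.IsLeftHopf) :
    B.TensR →ₗ[R] AdicCompletion I B.TensL :=
  BalTensor.lift
    (LinearMap.mk₂ R (fun x y => adicMap I (InnerTensor.outerMul R B.tgt x 1) (translL hB y))
      (fun x x' y => by
        rw [InnerTensor.outerMul_add_left]
        exact adicMap_add _ _ _ _)
      (fun c x y => by
        rw [InnerTensor.outerMul_smul_left]
        exact adicMap_smul _ _ _ _)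
      (fun x y y' => by rw [translL_add, map_add])
      (fun c x y => by rw [translL_smul, map_smul]))
    (fun a x y => by
      simp only [LinearMap.mk₂_apply, LinearMap.mulRight_apply, LinearMap.mulLeft_apply]
      rw [translL_s_mul hI, InnerTensor.adicMap_outerMul_outerMul, mul_one])

/-- The map `x ⊗ y ↦ x y₍₊₎ ⊗ y₍₋₎`. -/
noncomputable def splitR (hI : I.FG) (hB : B.IsRightHopf) :
    B.TensL →ₗ[R] AdicCompletion I B.TensR :=
  BalTensor.lift
    (LinearMap.mk₂ R (fun x y => adicMap I (InnerTensor.outerMul R B.s x 1) (translR hB y))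
      (fun x x' y => by
        rw [InnerTensor.outerMul_add_left]
        exact adicMap_add _ _ _ _)
      (fun c x y => by
        rw [InnerTensor.outerMul_smul_left]
        exact adicMap_smul _ _ _ _)
      (fun x y y' => by rw [translR_add, map_add])
      (fun c x y => by rw [translR_smul, map_smul]))
    (fun a x y => by
      simp only [LinearMap.mk₂_apply, LinearMap.mulRight_apply, LinearMap.mulLeft_apply]
      rw [translR_t_mul hI, InnerTensor.adicMap_outerMul_outerMul, mul_one])

theorem splitL_tensR (hI : I.FG) (hB : B.IsLeftHopf) (x y : U) :
    splitL hI hB (B.tensR x y) =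
      adicMap I (InnerTensor.outerMul R B.tgt x 1) (translL hB y) := rfl

theorem splitR_tensL (hI : I.FG) (hB : B.IsRightHopf) (x y : U) :
    splitR hI hB (B.tensL x y) =
      adicMap I (InnerTensor.outerMul R B.s x 1) (translR hB y) := rfl

/-- `u₍₊₎ u₍₋₎₊ ⊗ u₍₋₎₋ = 1 ⊗ u` -/
theorem splitL_translR (hI : I.FG) (hl : B.IsLeftHopf) (hr : B.IsRightHopf) (u : U) :
    hatExtend I (splitL hI hl) (translR hr u) = AdicCompletion.of I _ (B.tensL 1 u) := by
  -- The completed `splitL` is α_ℓ⁻¹ ∘ α_r, both sides sending x ⊗ y to x₁ y ⊗ x₂. Hence it takes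
  -- α_r⁻¹(1 ⊗ u) to α_ℓ⁻¹(1 ⊗ u) = 1 ⊗ u.
  have h : B.galoisL ∘ₗ hatExtend I (splitL hI hl) = B.galoisR := by
    refine adic_balTensor_hom_ext hI fun x y => ?_
    simp only [LinearMap.comp_apply]
    rw [hatExtend_of, splitL_tensR, galoisL_outerMul_translL hI, galoisR_of]
  refine hl.1 ?_
  rw [← LinearMap.comp_apply, h, galoisR_translR, galoisL_of, B.comul_one, adicMap_of,
    B.rmul_tens, one_mul, one_mul]

/-- `u₊ u₋₍₊₎ ⊗ u₋₍₋₎ = 1 ⊗ u` -/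
theorem splitR_translL (hI : I.FG) (hl : B.IsLeftHopf) (hr : B.IsRightHopf) (u : U) :
    hatExtend I (splitR hI hr) (translL hl u) = AdicCompletion.of I _ (B.tensR 1 u) := by
  -- Dually, the completed `splitR` is α_r⁻¹ ∘ α_ℓ, both sides sending x ⊗ y to x₁ ⊗ x₂ y; the
  -- element u ⊗ 1 is also α_r(1 ⊗ u).
  have h : B.galoisR ∘ₗ hatExtend I (splitR hI hr) = B.galoisL := by
    refine adic_balTensor_hom_ext hI fun x y => ?_
    simp only [LinearMap.comp_apply]
    rw [hatExtend_of, splitR_tensL, galoisR_outerMul_translR hI, galoisL_of]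
  refine hr.1 ?_
  rw [← LinearMap.comp_apply, h, galoisL_translL, galoisR_of, B.comul_one, adicMap_of,
    B.rmul_tens, one_mul, one_mul]

end LeftBialgebroid

/-! ### The right action on `▸P ⊗ M_◁` -/

section TensorAction

variable {R : Type*} [CommRing R] {I : Ideal R} {A U : Type*} [Ring A] [Algebra R A] [Ring U]
  [Algebra R U] {B : LeftBialgebroid I A U} {P M M' : Type*}
  [AddCommGroup P] [Module R P] [Module Uᵐᵒᵖ P] [IsScalarTower R Uᵐᵒᵖ P]
  [AddCommGroup M] [Module R M] [Module U M] [IsScalarTower R U M]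
  [AddCommGroup M'] [Module R M'] [Module U M'] [IsScalarTower R U M']

theorem AeRing.tensorAct_tensL (E : AeRing R A U) (p : P) (m : M) (x y : U) :
    E.tensorAct p m (E.tensL x y) = E.tensorAMk (op x • p) (y • m) := rfl

theorem AeRing.tensorAMk_add_left (E : AeRing R A U) (p p' : P) (m : M) :
    E.tensorAMk (p + p') m = E.tensorAMk p m + E.tensorAMk p' m :=
  LinearMap.map_add₂ (BalTensor.mk _ _) _ _ _

theorem AeRing.tensorAMk_add_right (E : AeRing R A U) (p : P) (m m' : M) :
    E.tensorAMk p (m + m') = E.tensorAMk p m + E.tensorAMk p m' :=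
  map_add (BalTensor.mk _ _ _) _ _

theorem AeRing.tensorAMk_smul_left (E : AeRing R A U) (c : R) (p : P) (m : M) :
    E.tensorAMk (c • p) m = c • E.tensorAMk p m :=
  LinearMap.map_smul₂ (BalTensor.mk _ _) _ _ _

theorem AeRing.tensorAMk_smul_right (E : AeRing R A U) (c : R) (p : P) (m : M) :
    E.tensorAMk p (c • m) = c • E.tensorAMk p m :=
  map_smul (BalTensor.mk _ _ _) _ _

theorem AeRing.tensorAMk_balanced (E : AeRing R A U) (a : A) (p : P) (m : M) :
    E.tensorAMk (op (E.tgt a) • p) m = E.tensorAMk p (E.tgt a • m) :=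
  BalTensor.tmul_eq (fun a : A => Algebra.lsmul R R P (op (E.tgt a)))
    (fun a : A => Algebra.lsmul R R M (E.tgt a)) a p m

/-- The map `p ⊗ m ↦ p ⊗ g(m)`. -/
noncomputable def tensorMap (g : M →ₗ[U] M') : B.tensorA P M →ₗ[R] B.tensorA P M' :=
  BalTensor.lift
    (LinearMap.mk₂ R (fun p m => B.tensorAMk p (g m))
      (fun p p' m => B.tensorAMk_add_left _ _ _)
      (fun c p m => B.tensorAMk_smul_left _ _ _)
      (fun p m m' => by rw [map_add, B.tensorAMk_add_right])
      (fun c p m => by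
        rw [← algebraMap_smul U c, map_smul, algebraMap_smul, B.tensorAMk_smul_right]))
    (fun a p m => by
      simp only [LinearMap.mk₂_apply, Algebra.lsmul_coe]
      rw [map_smul, B.tensorAMk_balanced])

theorem tensorMap_tensorAMk (g : M →ₗ[U] M') (p : P) (m : M) :
    tensorMap g (B.tensorAMk p m) = B.tensorAMk p (g m) := rfl

variable [IsAdicComplete I (B.tensorA P M)]

theorem adicExtend_tensorAct_smul_smul (hI : I.FG) (p : P) (m : M) (x y : U)
    (w : AdicCompletion I B.TensL) :
    adicExtend I (B.tensorAct (op x • p) (y • m)) w =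
      adicExtend I (B.tensorAct p m) (adicMap I (InnerTensor.outerMul R B.tgt x y) w) := by
  suffices h : adicExtend I (B.tensorAct (op x • p) (y • m)) =
      adicExtend I (B.tensorAct p m) ∘ₗ adicMap I (InnerTensor.outerMul R B.tgt x y) from
    LinearMap.congr_fun h w
  refine adic_balTensor_hom_ext hI fun u v => ?_
  simp only [LinearMap.comp_apply, adicMap_of, adicExtend_of]
  rw [InnerTensor.outerMul_tmul, B.tensorAct_tensL, B.tensorAct_tensL, op_mul, mul_smul, mul_smul]

/-- The operator `p ⊗ m ↦ p u₊ ⊗ u₋ m` on `▸P ⊗ M_◁`. -/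
noncomputable def tensorRact (hI : I.FG) (hB : B.IsLeftHopf) (u : U) :
    B.tensorA P M →ₗ[R] B.tensorA P M :=
  BalTensor.lift
    (LinearMap.mk₂ R
      (fun p m => adicExtend I (B.tensorAct p m) (LeftBialgebroid.translL hB u))
      (fun p p' m => by
        rw [← LinearMap.add_apply, ← adicExtend_add hI]
        congr 2
        exact BalTensor.hom_ext fun x y => by
          rw [LinearMap.add_apply, B.tensorAct_tensL, B.tensorAct_tensL, B.tensorAct_tensL,
            smul_add, B.tensorAMk_add_left])
      (fun c p m => by
        rw [← LinearMap.smul_apply, ← adicExtend_smul hI]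
        congr 2
        exact BalTensor.hom_ext fun x y => by
          rw [LinearMap.smul_apply, B.tensorAct_tensL, B.tensorAct_tensL, smul_comm,
            B.tensorAMk_smul_left])
      (fun p m m' => by
        rw [← LinearMap.add_apply, ← adicExtend_add hI]
        congr 2
        exact BalTensor.hom_ext fun x y => by
          rw [LinearMap.add_apply, B.tensorAct_tensL, B.tensorAct_tensL, B.tensorAct_tensL,
            smul_add, B.tensorAMk_add_right])
      (fun c p m => by
        rw [← LinearMap.smul_apply, ← adicExtend_smul hI]
        congr 2
        exact BalTensor.hom_ext fun x y => by
          rw [LinearMap.smul_apply, B.tensorAct_tensL, B.tensorAct_tensL, smul_comm y c m,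
            B.tensorAMk_smul_right]))
    -- The relation needed is p t(a) u₊ ⊗ u₋ m = p u₊ ⊗ u₋ t(a) m, supplied by `translL_balanced`.
    (fun a p m => by
      simp only [LinearMap.mk₂_apply, Algebra.lsmul_coe]
      have h₁ := adicExtend_tensorAct_smul_smul hI p m (B.tgt a) 1 (LeftBialgebroid.translL hB u)
      have h₂ := adicExtend_tensorAct_smul_smul hI p m 1 (B.tgt a) (LeftBialgebroid.translL hB u)
      rw [one_smul] at h₁
      rw [op_one, one_smul] at h₂
      rw [h₁, h₂, LeftBialgebroid.translL_balanced hI])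

theorem tensorRact_tensorAMk (hI : I.FG) (hB : B.IsLeftHopf) (u : U) (p : P) (m : M) :
    tensorRact hI hB u (B.tensorAMk p m) =
      adicExtend I (B.tensorAct p m) (LeftBialgebroid.translL hB u) := rfl

theorem tensorRact_smul_smul (hI : I.FG) (hB : B.IsLeftHopf) (u x y : U) (p : P) (m : M) :
    tensorRact hI hB u (B.tensorAMk (op x • p) (y • m)) =
      adicExtend I (B.tensorAct p m)
        (adicMap I (InnerTensor.outerMul R B.tgt x y) (LeftBialgebroid.translL hB u)) := by
  rw [tensorRact_tensorAMk, adicExtend_tensorAct_smul_smul hI]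

theorem tensorRact_add (hI : I.FG) (hB : B.IsLeftHopf) (u u' : U) :
    (tensorRact hI hB (u + u') : B.tensorA P M →ₗ[R] B.tensorA P M) =
      tensorRact hI hB u + tensorRact hI hB u' :=
  BalTensor.hom_ext fun p m => by
    rw [LinearMap.add_apply, tensorRact_tensorAMk, tensorRact_tensorAMk, tensorRact_tensorAMk,
      LeftBialgebroid.translL_add, map_add]

theorem tensorRact_smul (hI : I.FG) (hB : B.IsLeftHopf) (c : R) (u : U) :
    (tensorRact hI hB (c • u) : B.tensorA P M →ₗ[R] B.tensorA P M) = c • tensorRact hI hB u :=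
  BalTensor.hom_ext fun p m => by
    rw [LinearMap.smul_apply, tensorRact_tensorAMk, tensorRact_tensorAMk,
      LeftBialgebroid.translL_smul, map_smul]

/-- Shows that p ↦ p ⊗ m is Aᵒᵖ-linear, so that the unit takes values in Hom(P, P ⊗ M); a = 1 gives
the unit law of the action. -/
theorem tensorRact_s (hI : I.FG) (hB : B.IsLeftHopf) (a : A) (p : P) (m : M) :
    tensorRact hI hB (B.s a) (B.tensorAMk p m) = B.tensorAMk (op (B.s a) • p) m := by
  rw [tensorRact_tensorAMk, LeftBialgebroid.translL_s, adicExtend_of, B.tensorAct_tensL, one_smul]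

theorem tensorRact_one (hI : I.FG) (hB : B.IsLeftHopf) :
    (tensorRact hI hB 1 : B.tensorA P M →ₗ[R] B.tensorA P M) = LinearMap.id :=
  BalTensor.hom_ext fun p m => by
    rw [← map_one B.s, tensorRact_s, map_one, op_one, one_smul, LinearMap.id_apply]

theorem tensorRact_mul (hI : I.FG) (hB : B.IsLeftHopf) (u v : U) :
    (tensorRact hI hB (u * v) : B.tensorA P M →ₗ[R] B.tensorA P M) =
      tensorRact hI hB v ∘ₗ tensorRact hI hB u :=
  BalTensor.hom_ext fun p m => by
    -- On x ⊗ y both sides are p x v₊ ⊗ v₋ y m; taking x ⊗ y = u₊ ⊗ u₋, `translL_mul` identifies the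
    -- result with the action of uv.
    have h : tensorRact hI hB v ∘ₗ adicExtend I (B.tensorAct p m) =
        adicExtend I (B.tensorAct p m) ∘ₗ
          hatExtend I (InnerTensor.insertMid B.tgt I (LeftBialgebroid.translL hB v)
            fun a => LeftBialgebroid.translL_balanced hI hB a v) := by
      refine adic_balTensor_hom_ext hI fun x y => ?_
      simp only [LinearMap.comp_apply]
      rw [hatExtend_of, InnerTensor.insertMid_tmul, adicExtend_of, B.tensorAct_tensL,
        tensorRact_smul_smul]
    rw [LinearMap.comp_apply, tensorRact_tensorAMk, tensorRact_tensorAMk,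
      LeftBialgebroid.translL_mul hI]
    exact (LinearMap.congr_fun h _).symm

/-- The right `U`-module structure `(p ⊗ m) u = p u₊ ⊗ u₋ m` on `▸P ⊗ M_◁`. -/
@[reducible]
noncomputable def tensorRightModule (hI : I.FG) (hB : B.IsLeftHopf) :
    Module Uᵐᵒᵖ (B.tensorA P M) where
  smul u z := tensorRact hI hB u.unop z
  one_smul z := LinearMap.congr_fun (tensorRact_one hI hB) z
  mul_smul u v z := LinearMap.congr_fun (tensorRact_mul hI hB v.unop u.unop) z
  smul_zero u := map_zero (tensorRact hI hB u.unop)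
  smul_add u := map_add (tensorRact hI hB u.unop)
  add_smul u v z := LinearMap.congr_fun (tensorRact_add hI hB u.unop v.unop) z
  zero_smul z := by
    have := LinearMap.congr_fun (tensorRact_smul hI hB (0 : R) (0 : U)) z
    rw [zero_smul, zero_smul] at this
    exact this

theorem tensorMap_tensorRact [IsAdicComplete I (B.tensorA P M')] (hI : I.FG) (hB : B.IsLeftHopf)
    (g : M →ₗ[U] M') (u : U) (z : B.tensorA P M) :
    tensorMap g (tensorRact hI hB u z) = tensorRact hI hB u (tensorMap g z) := by
  suffices h : tensorMap g ∘ₗ tensorRact hI hB u =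
      (tensorRact hI hB u : _ →ₗ[R] B.tensorA P M') ∘ₗ tensorMap g from LinearMap.congr_fun h z
  refine BalTensor.hom_ext fun p m => ?_
  rw [LinearMap.comp_apply, LinearMap.comp_apply, tensorMap_tensorAMk, tensorRact_tensorAMk,
    tensorRact_tensorAMk]
  have h : tensorMap g ∘ₗ adicExtend I (B.tensorAct p m) =
      adicExtend I (B.tensorAct p (g m)) := by
    refine adic_balTensor_hom_ext hI fun x y => ?_
    rw [LinearMap.comp_apply, adicExtend_of, adicExtend_of, B.tensorAct_tensL, B.tensorAct_tensL,
      tensorMap_tensorAMk, map_smul]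
  exact LinearMap.congr_fun h _

end TensorAction

/-! ### The left action on `Hom(P, N)` -/

section HomAction

variable {R : Type*} [CommRing R] {I : Ideal R} {A U : Type*} [Ring A] [Algebra R A] [Ring U]
  [Algebra R U] {B : LeftBialgebroid I A U} {P N N' : Type*}
  [AddCommGroup P] [Module R P] [Module Uᵐᵒᵖ P] [IsScalarTower R Uᵐᵒᵖ P]
  [AddCommGroup N] [Module R N] [Module Uᵐᵒᵖ N] [IsScalarTower R Uᵐᵒᵖ N]
  [AddCommGroup N'] [Module R N'] [Module Uᵐᵒᵖ N'] [IsScalarTower R Uᵐᵒᵖ N']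

theorem AeRing.homAct_tensR (E : AeRing R A U) (φ : E.homA P N) (p : P) (x y : U) :
    E.homAct φ p (E.tensR x y) = op y • φ.1 (op x • p) := rfl

/-- Composition with a `U`-linear map. -/
noncomputable def homMap (g : N →ₗ[Uᵐᵒᵖ] N') : B.homA P N →ₗ[R] B.homA P N' where
  toFun φ := ⟨g.restrictScalars R ∘ₗ φ.1, fun a p => by
    rw [LinearMap.comp_apply, LinearMap.comp_apply, φ.2]
    exact map_smul g _ _⟩
  map_add' φ ψ := Subtype.ext (LinearMap.ext fun p => map_add g _ _)
  map_smul' c φ := Subtype.ext (LinearMap.ext fun p => map_smul (g.restrictScalars R) _ _)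

theorem homMap_apply (g : N →ₗ[Uᵐᵒᵖ] N') (φ : B.homA P N) (p : P) :
    (homMap g φ).1 p = g (φ.1 p) := rfl

variable [IsAdicComplete I N]

theorem adicExtend_homAct_smul (hI : I.FG) (φ : B.homA P N) (p : P) (x y : U)
    (w : AdicCompletion I B.TensR) :
    op y • adicExtend I (B.homAct φ (op x • p)) w =
      adicExtend I (B.homAct φ p) (adicMap I (InnerTensor.outerMul R B.s x y) w) := by
  suffices h : Algebra.lsmul R R N (op y) ∘ₗ adicExtend I (B.homAct φ (op x • p)) =
      adicExtend I (B.homAct φ p) ∘ₗ adicMap I (InnerTensor.outerMul R B.s x y) from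
    LinearMap.congr_fun h w
  refine adic_balTensor_hom_ext hI fun u v => ?_
  simp only [LinearMap.comp_apply, adicMap_of, adicExtend_of, Algebra.lsmul_coe]
  rw [InnerTensor.outerMul_tmul, B.homAct_tensR, B.homAct_tensR, op_mul, op_mul, mul_smul, mul_smul]

/-- The operator `φ ↦ (p ↦ φ(p u₍₊₎) u₍₋₎)` on `Hom(P, N)`. -/
noncomputable def homLact (hI : I.FG) (hB : B.IsRightHopf) (u : U) (φ : B.homA P N) :
    B.homA P N :=
  ⟨{ toFun := fun p => adicExtend I (B.homAct φ p) (LeftBialgebroid.translR hB u)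
     map_add' := fun p p' => by
        rw [← LinearMap.add_apply, ← adicExtend_add hI]
        congr 2
        exact BalTensor.hom_ext fun x y => by
          rw [LinearMap.add_apply, B.homAct_tensR, B.homAct_tensR, B.homAct_tensR,
            smul_add, map_add, smul_add]
     map_smul' := fun c p => by
        rw [RingHom.id_apply, ← LinearMap.smul_apply, ← adicExtend_smul hI]
        congr 2
        exact BalTensor.hom_ext fun x y => by
          rw [LinearMap.smul_apply, B.homAct_tensR, B.homAct_tensR, smul_comm (op x) c p,
            map_smul, smul_comm] },
    fun a p => by
      -- Aᵒᵖ-linearity of uφ reads φ(p s(a) u₍₊₎) u₍₋₎ = φ(p u₍₊₎) u₍₋₎ s(a), which is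
      -- `translR_balanced`.
      have h₁ := adicExtend_homAct_smul hI φ p (B.s a) 1 (LeftBialgebroid.translR hB u)
      have h₂ := adicExtend_homAct_smul hI φ p 1 (B.s a) (LeftBialgebroid.translR hB u)
      rw [op_one, one_smul] at h₁
      rw [op_one, one_smul] at h₂
      exact h₁.trans ((congrArg _ (LeftBialgebroid.translR_balanced hI hB a u)).trans h₂.symm)⟩

theorem homLact_apply (hI : I.FG) (hB : B.IsRightHopf) (u : U) (φ : B.homA P N) (p : P) :
    (homLact hI hB u φ).1 p = adicExtend I (B.homAct φ p) (LeftBialgebroid.translR hB u) := rfl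

theorem smul_homLact_smul (hI : I.FG) (hB : B.IsRightHopf) (u x y : U) (φ : B.homA P N) (p : P) :
    op y • (homLact hI hB u φ).1 (op x • p) =
      adicExtend I (B.homAct φ p)
        (adicMap I (InnerTensor.outerMul R B.s x y) (LeftBialgebroid.translR hB u)) := by
  rw [homLact_apply, adicExtend_homAct_smul hI]

/-- On t(A) the new action is the operation ◁ on Hom(P, N), so the tensor product formed with the
`U`-module structure matches the one in the evaluation hypothesis. -/
theorem homLact_t (hI : I.FG) (hB : B.IsRightHopf) (a : A) (φ : B.homA P N) (p : P) :
    (homLact hI hB (B.tgt a) φ).1 p = φ.1 (op (B.tgt a) • p) := by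
  rw [homLact_apply, LeftBialgebroid.translR_t, adicExtend_of, B.homAct_tensR, op_one, one_smul]

theorem homLact_mul (hI : I.FG) (hB : B.IsRightHopf) (u v : U) (φ : B.homA P N) :
    homLact hI hB (u * v) φ = homLact hI hB u (homLact hI hB v φ) := by
  refine Subtype.ext (LinearMap.ext fun p => ?_)
  have h : adicExtend I (B.homAct (homLact hI hB v φ) p) =
      adicExtend I (B.homAct φ p) ∘ₗ
        hatExtend I (InnerTensor.insertMid B.s I (LeftBialgebroid.translR hB v)
          fun a => LeftBialgebroid.translR_balanced hI hB a v) := by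
    refine adic_balTensor_hom_ext hI fun x y => ?_
    rw [LinearMap.comp_apply, hatExtend_of, InnerTensor.insertMid_tmul, adicExtend_of,
      B.homAct_tensR, smul_homLact_smul]
  rw [homLact_apply, homLact_apply, LeftBialgebroid.translR_mul hI]
  exact (LinearMap.congr_fun h _).symm

theorem homLact_add_left (hI : I.FG) (hB : B.IsRightHopf) (u v : U) (φ : B.homA P N) :
    homLact hI hB (u + v) φ = homLact hI hB u φ + homLact hI hB v φ := by
  refine Subtype.ext (LinearMap.ext fun p => ?_)
  rw [Submodule.coe_add, LinearMap.add_apply, homLact_apply, homLact_apply, homLact_apply,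
    LeftBialgebroid.translR_add, map_add]

theorem homLact_smul_left (hI : I.FG) (hB : B.IsRightHopf) (c : R) (u : U) (φ : B.homA P N) :
    homLact hI hB (c • u) φ = c • homLact hI hB u φ := by
  refine Subtype.ext (LinearMap.ext fun p => ?_)
  rw [Submodule.coe_smul, LinearMap.smul_apply, homLact_apply, homLact_apply,
    LeftBialgebroid.translR_smul, map_smul]

theorem homLact_add_right (hI : I.FG) (hB : B.IsRightHopf) (u : U) (φ ψ : B.homA P N) :
    homLact hI hB u (φ + ψ) = homLact hI hB u φ + homLact hI hB u ψ := by
  refine Subtype.ext (LinearMap.ext fun p => ?_)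
  rw [Submodule.coe_add, LinearMap.add_apply, homLact_apply, homLact_apply, homLact_apply,
    ← LinearMap.add_apply, ← adicExtend_add hI]
  congr 2
  exact BalTensor.hom_ext fun x y => by
    rw [LinearMap.add_apply, B.homAct_tensR, B.homAct_tensR, B.homAct_tensR, Submodule.coe_add,
      LinearMap.add_apply, smul_add]

/-- The left `U`-module structure `(u φ)(p) = φ(p u₍₊₎) u₍₋₎` on `Hom(P, N)`. -/
@[reducible]
noncomputable def homLeftModule (hI : I.FG) (hB : B.IsRightHopf) : Module U (B.homA P N) where
  smul u φ := homLact hI hB u φ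
  one_smul φ := Subtype.ext (LinearMap.ext fun p => by
    change (homLact hI hB 1 φ).1 p = _
    rw [← B.tgt_one, homLact_t, B.tgt_one, op_one, one_smul])
  mul_smul u v φ := homLact_mul hI hB u v φ
  smul_zero u := by
    have := homLact_add_right hI hB u (0 : B.homA P N) 0
    rw [add_zero] at this
    exact left_eq_add.1 this
  smul_add u φ ψ := homLact_add_right hI hB u φ ψ
  add_smul u v φ := homLact_add_left hI hB u v φ
  zero_smul φ := by
    have := homLact_add_left hI hB 0 0 φ
    rw [add_zero] at this
    exact left_eq_add.1 this

theorem homMap_homLact [IsAdicComplete I N'] (hI : I.FG) (hB : B.IsRightHopf)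
    (g : N →ₗ[Uᵐᵒᵖ] N') (u : U) (φ : B.homA P N) :
    homMap g (homLact hI hB u φ) = homLact hI hB u (homMap g φ) := by
  refine Subtype.ext (LinearMap.ext fun p => ?_)
  rw [homMap_apply, homLact_apply, homLact_apply]
  have h : g.restrictScalars R ∘ₗ adicExtend I (B.homAct φ p) =
      adicExtend I (B.homAct (homMap g φ) p) := by
    refine adic_balTensor_hom_ext hI fun x y => ?_
    rw [LinearMap.comp_apply, adicExtend_of, adicExtend_of, B.homAct_tensR, B.homAct_tensR,
      homMap_apply]
    exact map_smul g _ _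
  exact LinearMap.congr_fun h _

end HomAction

/-! ### Dual bases and completeness of P ⊗ M and Hom(P, N) -/

theorem exists_dualBasis (S P : Type*) [Ring S] [AddCommGroup P] [Module S P] [Module.Finite S P]
    [Module.Projective S P] :
    ∃ (n : ℕ) (e : Fin n → P) (f : Fin n → P →ₗ[S] S), ∀ p, ∑ i, f i p • e i = p := by
  obtain ⟨n, g, h, -, -, hgh⟩ := Module.Finite.exists_comp_eq_id_of_projective S P
  refine ⟨n, fun i => g (Pi.single i 1), fun i => LinearMap.proj i ∘ₗ h, fun p => ?_⟩
  have := LinearMap.congr_fun hgh p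
  rw [LinearMap.comp_apply, LinearMap.id_apply] at this
  conv_rhs => rw [← this, LinearMap.pi_apply_eq_sum_univ g (h p)]
  refine Finset.sum_congr rfl fun i _ => congrArg (fun x => h p i • g x) (funext fun j => ?_)
  simp [Pi.single_apply, eq_comm]

namespace AeRing

variable {R : Type*} [CommRing R] {A U : Type*} [Ring A] [Algebra R A] [Ring U]
  [Algebra R U] {E : AeRing R A U} {P N M : Type*}
  [AddCommGroup P] [Module R P] [Module Uᵐᵒᵖ P] [IsScalarTower R Uᵐᵒᵖ P]
  [AddCommGroup N] [Module R N] [Module Uᵐᵒᵖ N] [IsScalarTower R Uᵐᵒᵖ N]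
  [AddCommGroup M] [Module R M] [Module U M] [IsScalarTower R U M]

theorem op_s_algebraMap_smul (E : AeRing R A U) (c : R) (p : P) :
    op (E.s (algebraMap R A c)) • p = c • p := by
  rw [AlgHom.commutes, ← algebraMap_smul Uᵐᵒᵖ c p]
  rfl

theorem op_tgt_algebraMap_smul (E : AeRing R A U) (c : R) (p : P) :
    op (E.tgt (algebraMap R A c)) • p = c • p := by
  rw [tgt, AlgHom.commutes, ← algebraMap_smul Uᵐᵒᵖ c p]
  rfl

/-- Dual bases of `P_◂`. -/
theorem IsFGProjectiveRight.exists_dualBasis (hP : E.IsFGProjectiveRight P) :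
    ∃ (n : ℕ) (e : Fin n → P) (f : Fin n → P →ₗ[R] A),
      (∀ i a p, f i (op (E.s a) • p) = f i p * a) ∧ ∀ p, ∑ i, op (E.s (f i p)) • e i = p := by
  let _ : Module Aᵐᵒᵖ P := Module.compHom P (AlgHom.op E.s).toRingHom
  have := hP.1
  have := hP.2
  obtain ⟨n, e, f, h⟩ := HopfAlgd.exists_dualBasis Aᵐᵒᵖ P
  have hf (i : Fin n) (a : A) (p : P) : unop (f i (op (E.s a) • p)) = unop (f i p) * a :=
    congrArg unop (map_smul (f i) (op a) p)
  refine ⟨n, e, fun i =>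
    { toFun := fun p => unop (f i p)
      map_add' := fun p q => by rw [map_add, MulOpposite.unop_add]
      map_smul' := fun c p => ?_ }, hf, h⟩
  -- `R`-linearity is a case of `A`-linearity: a scalar c acts on P as s(c), and its image in `A` is
  -- central.
  rw [← E.op_s_algebraMap_smul, hf, ← Algebra.commutes, ← Algebra.smul_def, RingHom.id_apply]

/-- Dual bases of `▸P`. -/
theorem IsFGProjectiveLeft.exists_dualBasis (hP : E.IsFGProjectiveLeft P) :
    ∃ (n : ℕ) (e : Fin n → P) (f : Fin n → P →ₗ[R] A),
      (∀ i a p, f i (op (E.tgt a) • p) = a * f i p) ∧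
        ∀ p, ∑ i, op (E.tgt (f i p)) • e i = p := by
  let _ : Module A P := Module.compHom P E.t.toRingHom
  have := hP.1
  have := hP.2
  obtain ⟨n, e, f, h⟩ := HopfAlgd.exists_dualBasis A P
  have hf (i : Fin n) (a : A) (p : P) : f i (op (E.tgt a) • p) = a * f i p :=
    map_smul (f i) a p
  refine ⟨n, e, fun i =>
    { toFun := fun p => f i p
      map_add' := map_add (f i)
      map_smul' := fun c p => ?_ }, hf, h⟩
  rw [← E.op_tgt_algebraMap_smul, hf, ← Algebra.smul_def, RingHom.id_apply]

/-- The maps `p ↦ n s(f(p))`, for an `A`-linear form `f` on `P_◂`. -/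
def rankOneHom (f : P →ₗ[R] A) (hf : ∀ a p, f (op (E.s a) • p) = f p * a) :
    N →ₗ[R] E.homA P N where
  toFun n :=
    ⟨{ toFun := fun p => op (E.s (f p)) • n
       map_add' := fun p q => by rw [map_add, map_add, MulOpposite.op_add, add_smul]
       map_smul' := fun c p => by
        rw [map_smul, map_smul, op_smul, smul_assoc, RingHom.id_apply] },
      fun a p => by
        simp only [LinearMap.coe_mk, AddHom.coe_mk]
        rw [hf, map_mul, op_mul, mul_smul]⟩
  map_add' n n' := Subtype.ext (LinearMap.ext fun p => smul_add _ _ _)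
  map_smul' c n := Subtype.ext (LinearMap.ext fun p => smul_comm _ _ _)

theorem rankOneHom_apply (f : P →ₗ[R] A) (hf : ∀ a p, f (op (E.s a) • p) = f p * a) (n : N)
    (p : P) : (E.rankOneHom f hf n).1 p = op (E.s (f p)) • n := rfl

/-- Hom(P, N) is a retract of Nⁿ through φ ↦ (φ(eᵢ)), because φ(p) = ∑ φ(eᵢ) s(fᵢ(p)). -/
theorem isAdicComplete_homA {I : Ideal R} (hI : I.FG) (hP : E.IsFGProjectiveRight P)
    [IsAdicComplete I N] : IsAdicComplete I (E.homA P N) := by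
  obtain ⟨n, e, f, hf, h⟩ := hP.exists_dualBasis (R := R)
  have := isAdicComplete_pi (Q := N) hI n
  refine isAdicComplete_of_retract (Q' := Fin n → N)
    (LinearMap.pi fun i => LinearMap.applyₗ (e i) ∘ₗ (E.homA P N).subtype)
    (∑ i, E.rankOneHom (f i) (hf i) ∘ₗ LinearMap.proj i) fun φ => ?_
  refine Subtype.ext (LinearMap.ext fun p => ?_)
  conv_rhs => rw [← h p, map_sum]
  rw [LinearMap.sum_apply, AddSubmonoidClass.coe_finsetSum, LinearMap.sum_apply]
  refine Finset.sum_congr rfl fun i _ => ?_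
  rw [φ.2]
  rfl

/-- The map `p ⊗ m ↦ t(f(p)) m`, for an `A`-linear form `f` on `▸P`. -/
noncomputable def contract (f : P →ₗ[R] A) (hf : ∀ a p, f (op (E.tgt a) • p) = a * f p) :
    E.tensorA P M →ₗ[R] M :=
  BalTensor.lift
    (LinearMap.mk₂ R (fun p m => E.tgt (f p) • m)
      (fun p p' m => by rw [map_add, tgt_add, add_smul])
      (fun c p m => by rw [map_smul, tgt_smul, smul_assoc])
      (fun p m m' => smul_add _ _ _)
      (fun c p m => smul_comm _ _ _))
    (fun a p m => by
      simp only [LinearMap.mk₂_apply, Algebra.lsmul_coe]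
      rw [hf, tgt_mul, mul_smul])

theorem contract_tensorAMk (f : P →ₗ[R] A) (hf : ∀ a p, f (op (E.tgt a) • p) = a * f p) (p : P)
    (m : M) : E.contract f hf (E.tensorAMk p m) = E.tgt (f p) • m := rfl

/-- P ⊗ M is a retract of Mⁿ through p ⊗ m ↦ (t(fᵢ(p)) m), with retraction (mᵢ) ↦ ∑ eᵢ ⊗ mᵢ. -/
theorem isAdicComplete_tensorA {I : Ideal R} (hI : I.FG) (hP : E.IsFGProjectiveLeft P)
    [IsAdicComplete I M] : IsAdicComplete I (E.tensorA P M) := by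
  obtain ⟨n, e, f, hf, h⟩ := hP.exists_dualBasis (R := R)
  have := isAdicComplete_pi (Q := M) hI n
  let r : (Fin n → M) →ₗ[R] E.tensorA P M := ∑ i, BalTensor.mk _ _ (e i) ∘ₗ LinearMap.proj i
  let i : E.tensorA P M →ₗ[R] Fin n → M := LinearMap.pi fun i => E.contract (f i) (hf i)
  suffices hri : r ∘ₗ i = LinearMap.id from
    isAdicComplete_of_retract i r (LinearMap.congr_fun hri)
  refine BalTensor.hom_ext fun p m => ?_
  rw [LinearMap.comp_apply, LinearMap.sum_apply, LinearMap.id_apply]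
  have hm : E.tensorAMk p m = ∑ i, E.tensorAMk (op (E.tgt (f i p)) • e i) m := by
    conv_lhs => rw [← h p]
    exact map_sum ((BalTensor.mk _ _).flip m) _ _
  refine Eq.trans (Finset.sum_congr rfl fun i _ => ?_) hm.symm
  rw [E.tensorAMk_balanced]
  rfl

variable (E P) in
/-- The map `a ↦ (p ↦ a ▸ p)`. -/
def blactLinear : A →ₗ[R] E.homA P P where
  toFun a := E.blact a
  map_add' a b := Subtype.ext (LinearMap.ext fun p => by
    change op (E.tgt (a + b)) • p = op (E.tgt a) • p + op (E.tgt b) • p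
    rw [tgt_add, MulOpposite.op_add, add_smul])
  map_smul' c a := Subtype.ext (LinearMap.ext fun p => by
    change op (E.tgt (c • a)) • p = c • op (E.tgt a) • p
    rw [tgt_smul, op_smul, smul_assoc])

end AeRing

variable {R : Type*} [CommRing R] {I : Ideal R} {A U : Type*} [Ring A] [Algebra R A] [Ring U]
  [Algebra R U] {B : LeftBialgebroid I A U} {P M N T H : Type*}
  [AddCommGroup P] [Module R P] [Module Uᵐᵒᵖ P] [IsScalarTower R Uᵐᵒᵖ P]
  [AddCommGroup M] [Module R M] [Module U M] [IsScalarTower R U M]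
  [AddCommGroup N] [Module R N] [Module Uᵐᵒᵖ N] [IsScalarTower R Uᵐᵒᵖ N]
  [AddCommGroup T] [Module R T] [Module Uᵐᵒᵖ T] [IsScalarTower R Uᵐᵒᵖ T]
  [AddCommGroup H] [Module R H] [Module U H] [IsScalarTower R U H]

/-! ### The unit: linearity and bijectivity -/

section Unit

variable [IsAdicComplete I (B.tensorA P M)] (hI : I.FG) (hl : B.IsLeftHopf)
  (θ : T ≃ₗ[R] B.tensorA P M) (hθ : ∀ u z, θ (op u • z) = tensorRact hI hl u (θ z))

/-- The unit `m ↦ (p ↦ p ⊗ m)`. -/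
noncomputable def unitMap : M →ₗ[R] B.homA P T where
  toFun m :=
    ⟨θ.symm.toLinearMap ∘ₗ (BalTensor.mk _ _).flip m, fun a p => by
      refine θ.injective ?_
      rw [hθ, LinearMap.comp_apply, LinearMap.comp_apply, LinearEquiv.coe_coe,
        LinearEquiv.apply_symm_apply, LinearEquiv.apply_symm_apply]
      exact (tensorRact_s hI hl a p m).symm⟩
  map_add' m m' := Subtype.ext (LinearMap.ext fun p => by
    change θ.symm (B.tensorAMk p (m + m')) = θ.symm (B.tensorAMk p m) + θ.symm (B.tensorAMk p m')
    rw [B.tensorAMk_add_right, map_add])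
  map_smul' c m := Subtype.ext (LinearMap.ext fun p => by
    change θ.symm (B.tensorAMk p (c • m)) = c • θ.symm (B.tensorAMk p m)
    rw [B.tensorAMk_smul_right, map_smul])

theorem unitMap_apply (m : M) (p : P) :
    θ ((unitMap hI hl θ hθ m).1 p) = B.tensorAMk p m :=
  θ.apply_symm_apply _

/-- With η the unit, (u η(m))(p) = p u₍₊₎ u₍₋₎₊ ⊗ u₍₋₎₋ m, and `splitL_translR` collapses this to p
⊗ um. -/
theorem unitMap_smul [IsAdicComplete I T] (hr : B.IsRightHopf) (u : U) (m : M) :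
    unitMap hI hl θ hθ (u • m) = homLact hI hr u (unitMap hI hl θ hθ m) := by
  refine Subtype.ext (LinearMap.ext fun p => θ.injective ?_)
  have h : θ.toLinearMap ∘ₗ adicExtend I (B.homAct (unitMap hI hl θ hθ m) p) =
      adicExtend I (B.tensorAct p m) ∘ₗ hatExtend I (LeftBialgebroid.splitL hI hl) := by
    refine adic_balTensor_hom_ext hI fun x y => ?_
    rw [LinearMap.comp_apply, LinearMap.comp_apply, hatExtend_of, adicExtend_of,
      LeftBialgebroid.splitL_tensR, B.homAct_tensR, LinearEquiv.coe_coe, hθ, unitMap_apply,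
      ← adicExtend_tensorAct_smul_smul hI, one_smul, tensorRact_tensorAMk]
  have h' := LinearMap.congr_fun h (LeftBialgebroid.translR hr u)
  rw [LinearMap.comp_apply, LinearMap.comp_apply, LeftBialgebroid.splitL_translR hI,
    adicExtend_of, B.tensorAct_tensL, op_one, one_smul] at h'
  rw [unitMap_apply]
  exact h'.symm

/-- An explicit form of Hom(P, P ⊗ M) ≅ Hom(P, P) ⊗ M ≅ A ⊗ M: dual bases expand a homomorphism into
rank-one pieces, and each rank-one endomorphism of P is q ↦ q t(a) for a unique a. -/
theorem unitMap_bijective (hP : B.IsFGProjectiveRight P)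
    (h_end : Function.Bijective (fun a : A => (B.blact a : B.homA P P))) :
    Function.Bijective (unitMap hI hl θ hθ) := by
  obtain ⟨n, e, f, hf, h⟩ := hP.exists_dualBasis (R := R)
  let σ : A ≃ₗ[R] B.homA P P := LinearEquiv.ofBijective (B.blactLinear P) h_end
  have hσ (φ : B.homA P P) (p : P) : op (B.tgt (σ.symm φ)) • p = φ.1 p :=
    LinearMap.congr_fun (congrArg Subtype.val (σ.apply_symm_apply φ)) p
  have hσ' (a : A) (φ : B.homA P P) (hφ : ∀ p, op (B.tgt a) • p = φ.1 p) : σ.symm φ = a :=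
    σ.symm_apply_eq.2 (Subtype.ext (LinearMap.ext fun p => (hφ p).symm))
  -- cᵢ(p) is the element of `A` with q t(cᵢ(p)) = p s(fᵢ(q)) for all q. It is left `A`-linear for
  -- ▸P because the images of s and t commute, so contraction against cᵢ is defined on P ⊗ M.
  let c (i : Fin n) : P →ₗ[R] A := σ.symm.toLinearMap ∘ₗ B.rankOneHom (f i) (hf i)
  have hc (i : Fin n) (a : A) (p : P) : c i (op (B.tgt a) • p) = a * c i p := by
    refine hσ' _ _ fun q => ?_
    rw [B.tgt_mul, op_mul, mul_smul]
    refine (congrArg (op (B.tgt a) • ·) (hσ _ q)).trans ?_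
    simp only [AeRing.rankOneHom_apply]
    rw [smul_smul, smul_smul, ← op_mul, ← op_mul, B.s_tgt]
  -- The sum acts on P by q ↦ ∑ eᵢ s(fᵢ(q)) = q.
  have hc_sum : ∑ i, c i (e i) = 1 := by
    change ∑ i, σ.symm (B.rankOneHom (f i) (hf i) (e i)) = 1
    rw [← map_sum]
    refine hσ' _ _ fun p => ?_
    rw [B.tgt_one, op_one, one_smul, AddSubmonoidClass.coe_finsetSum, LinearMap.sum_apply]
    exact (h p).symm
  -- For z = q ⊗ m: p ⊗ t(cᵢ(q))m = p t(cᵢ(q)) ⊗ m = q s(fᵢ(p)) ⊗ m = z s(fᵢ(p)).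
  have htensor (i : Fin n) (z : B.tensorA P M) (p : P) :
      B.tensorAMk p (B.contract (c i) (hc i) z) = tensorRact hI hl (B.s (f i p)) z := by
    suffices h' : BalTensor.mk _ _ p ∘ₗ B.contract (c i) (hc i) =
        tensorRact hI hl (B.s (f i p)) from LinearMap.congr_fun h' z
    refine BalTensor.hom_ext fun q m => ?_
    rw [tensorRact_s, LinearMap.comp_apply, AeRing.contract_tensorAMk]
    refine (B.tensorAMk_balanced _ p m).symm.trans ?_
    exact congrArg (fun p => B.tensorAMk p m) (hσ _ p)
  have hsum (g : Fin n → M) (p : P) : ∑ i, B.tensorAMk p (g i) = B.tensorAMk p (∑ i, g i) :=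
    (map_sum (BalTensor.mk _ _ p) _ _).symm
  -- The inverse sums the contractions of ψ(eᵢ) against cᵢ. One composite is the identity by
  -- `hc_sum`, the other by `htensor` and ψ(p) = ∑ ψ(eᵢ) s(fᵢ(p)).
  refine Function.bijective_iff_has_inverse.2
    ⟨fun ψ => ∑ i, B.contract (c i) (hc i) (θ (ψ.1 (e i))), fun m => ?_, fun ψ => ?_⟩
  · simp only [unitMap_apply, AeRing.contract_tensorAMk]
    rw [← Finset.sum_smul]
    have : ∑ i, B.tgt (c i (e i)) = B.tgt (∑ i, c i (e i)) := by simp [AeRing.tgt]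
    rw [this, hc_sum, B.tgt_one, one_smul]
  · refine Subtype.ext (LinearMap.ext fun p => θ.injective ?_)
    rw [unitMap_apply, ← hsum]
    simp only [htensor]
    conv_rhs => rw [← h p, map_sum, map_sum]
    exact Finset.sum_congr rfl fun i _ => by rw [ψ.2, hθ]

end Unit

/-! ### The counit: linearity and bijectivity -/

section Counit

variable [IsAdicComplete I N] (hI : I.FG) (hr : B.IsRightHopf)
  (θ : H ≃ₗ[R] B.homA P N) (hθ : ∀ u φ, θ (u • φ) = homLact hI hr u (θ φ))

/-- The counit `p ⊗ φ ↦ φ(p)`. -/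
noncomputable def counitMap : B.tensorA P H →ₗ[R] N :=
  BalTensor.lift (((B.homA P N).subtype ∘ₗ θ.toLinearMap).flip) fun a p φ => by
    change (θ φ).1 (op (B.tgt a) • p) = (θ (B.tgt a • φ)).1 p
    rw [hθ, homLact_t]

theorem counitMap_tensorAMk (p : P) (φ : H) :
    counitMap hI hr θ hθ (B.tensorAMk p φ) = (θ φ).1 p := rfl

/-- The image of (p ⊗ φ)u is φ(p u₊ u₋₍₊₎) u₋₍₋₎, which `splitR_translL` collapses to φ(p)u. -/
theorem counitMap_tensorRact [IsAdicComplete I (B.tensorA P H)] (hl : B.IsLeftHopf) (u : U)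
    (z : B.tensorA P H) :
    counitMap hI hr θ hθ (tensorRact hI hl u z) = op u • counitMap hI hr θ hθ z := by
  suffices h : counitMap hI hr θ hθ ∘ₗ tensorRact hI hl u =
      Algebra.lsmul R R N (op u) ∘ₗ counitMap hI hr θ hθ from LinearMap.congr_fun h z
  refine BalTensor.hom_ext fun p φ => ?_
  have h : counitMap hI hr θ hθ ∘ₗ adicExtend I (B.tensorAct p φ) =
      adicExtend I (B.homAct (θ φ) p) ∘ₗ hatExtend I (LeftBialgebroid.splitR hI hr) := by
    refine adic_balTensor_hom_ext hI fun x y => ?_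
    rw [LinearMap.comp_apply, LinearMap.comp_apply, hatExtend_of, adicExtend_of,
      LeftBialgebroid.splitR_tensL, B.tensorAct_tensL, counitMap_tensorAMk, hθ,
      ← adicExtend_homAct_smul hI, op_one, one_smul, homLact_apply]
  have h' := LinearMap.congr_fun h (LeftBialgebroid.translL hl u)
  rw [LinearMap.comp_apply, LinearMap.comp_apply, LeftBialgebroid.splitR_translL hI,
    adicExtend_of, B.homAct_tensR, op_one, one_smul] at h'
  exact h'

/-- The hypothesis concerns the tensor product balanced by ◁; by `homLact_t` this agrees with the
`t`-action on H, so θ induces an isomorphism of tensor products turning the counit into evaluation.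
-/
theorem counitMap_bijective (h_eval : Function.Bijective (B.evalMap P N)) :
    Function.Bijective (counitMap hI hr θ hθ) := by
  have hact (a : A) (φ : H) : θ (B.tgt a • φ) = B.homRact a (θ φ) :=
    Subtype.ext (LinearMap.ext fun p => by rw [hθ, homLact_t]; rfl)
  let g : B.tensorA P H →ₗ[R] B.tensorHom P N :=
    BalTensor.lift ((BalTensor.mk _ _).compl₂ θ.toLinearMap) fun a p φ => by
      simp only [LinearMap.compl₂_apply, LinearEquiv.coe_coe, Algebra.lsmul_coe, hact]
      exact BalTensor.tmul_eq (fun a : A => Algebra.lsmul R R P (op (B.tgt a)))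
        (fun a : A => (B.homRact a : Module.End R (B.homA P N))) a p (θ φ)
  let g' : B.tensorHom P N →ₗ[R] B.tensorA P H :=
    BalTensor.lift ((BalTensor.mk _ _).compl₂ θ.symm.toLinearMap) fun a p φ => by
      have : θ.symm (B.homRact a φ) = B.tgt a • θ.symm φ := by
        rw [LinearEquiv.symm_apply_eq, hact, LinearEquiv.apply_symm_apply]
      simp only [LinearMap.compl₂_apply, LinearEquiv.coe_coe, this]
      exact B.tensorAMk_balanced a p (θ.symm φ)
  have hg₁ : g ∘ₗ g' = LinearMap.id := BalTensor.hom_ext fun p φ =>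
    congrArg (BalTensor.mk _ _ p) (θ.apply_symm_apply φ)
  have hg₂ : g' ∘ₗ g = LinearMap.id := BalTensor.hom_ext fun p φ =>
    congrArg (BalTensor.mk _ _ p) (θ.symm_apply_apply φ)
  have hcomp : counitMap hI hr θ hθ = B.evalMap P N ∘ₗ g := BalTensor.hom_ext fun p φ => rfl
  rw [hcomp, LinearMap.coe_comp]
  exact h_eval.comp (Function.bijective_iff_has_inverse.2
    ⟨g', LinearMap.congr_fun hg₂, LinearMap.congr_fun hg₁⟩)

end Counit

/-! ### The functors and the equivalence -/

section Functors

variable {R : Type*} [CommRing R] {I : Ideal R} {A U : Type*} [Ring A] [Algebra R A] [Ring U]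
  [Algebra R U] {B : LeftBialgebroid I A U}

instance CompleteLeft.isAdicComplete (M : CompleteLeft.{v} I U) : IsAdicComplete I M.obj :=
  M.property

instance CompleteRight.isAdicComplete (N : CompleteRight.{v} I U) : IsAdicComplete I N.obj :=
  N.property

variable {P : ModuleCat.{v} Uᵐᵒᵖ}

section Constructions

variable (hI : I.FG)

section Tensor

variable (hl : B.IsLeftHopf)

/-- `▸P ⊗ M_◁` as a right `U`-module. -/
noncomputable def tensorModuleCat (P : ModuleCat.{v} Uᵐᵒᵖ) (M : CompleteLeft.{v} I U)
    [IsAdicComplete I (B.tensorA P M.obj)] : ModuleCat.{v} Uᵐᵒᵖ :=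
  letI := tensorRightModule (P := P) (M := M.obj) hI hl
  ModuleCat.of Uᵐᵒᵖ (B.tensorA P M.obj)

/-- The underlying `R`-module of `tensorModuleCat`. -/
noncomputable def tensorModuleCatEquiv (P : ModuleCat.{v} Uᵐᵒᵖ) (M : CompleteLeft.{v} I U)
    [IsAdicComplete I (B.tensorA P M.obj)] :
    tensorModuleCat hI hl P M ≃ₗ[R] B.tensorA P M.obj :=
  { (Equiv.refl _ : tensorModuleCat hI hl P M ≃ B.tensorA P M.obj) with
    map_add' := fun _ _ => rfl
    map_smul' := fun c z => by
      change tensorRact hI hl (algebraMap R U c) _ = _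
      rw [Algebra.algebraMap_eq_smul_one, tensorRact_smul, tensorRact_one]
      rfl }

variable (hP : B.IsFGProjectiveLeft P)

/-- The functor `M ↦ ▸P ⊗ M_◁`. -/
noncomputable def tensorFunctor : CompleteLeft.{v} I U ⥤ CompleteRight.{v} I U where
  obj M :=
    haveI := AeRing.isAdicComplete_tensorA (M := M.obj) hI hP
    ⟨tensorModuleCat hI hl P M, isAdicComplete_of_retract
      (tensorModuleCatEquiv hI hl P M).toLinearMap (tensorModuleCatEquiv hI hl P M).symm.toLinearMap
      (tensorModuleCatEquiv hI hl P M).symm_apply_apply⟩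
  map {M M'} f :=
    haveI := AeRing.isAdicComplete_tensorA (M := M.obj) hI hP
    haveI := AeRing.isAdicComplete_tensorA (M := M'.obj) hI hP
    ObjectProperty.homMk (ModuleCat.ofHom (X := tensorModuleCat hI hl P M)
      (Y := tensorModuleCat hI hl P M')
      { toFun := tensorMap (B := B) (P := P) f.hom.hom
        map_add' := map_add (tensorMap (B := B) (P := P) f.hom.hom)
        map_smul' := fun u z => tensorMap_tensorRact hI hl f.hom.hom u.unop z })
  map_id M := by
    refine ObjectProperty.hom_ext _ (ModuleCat.hom_ext (LinearMap.ext fun z => ?_))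
    have : tensorMap (B := B) (P := P) (LinearMap.id : M.obj →ₗ[U] M.obj) = LinearMap.id :=
      BalTensor.hom_ext fun _ _ => rfl
    exact LinearMap.congr_fun this z
  map_comp {M M' M''} f g := by
    refine ObjectProperty.hom_ext _ (ModuleCat.hom_ext (LinearMap.ext fun z => ?_))
    have : tensorMap (B := B) (P := P) (g.hom.hom ∘ₗ f.hom.hom) =
        tensorMap g.hom.hom ∘ₗ tensorMap f.hom.hom :=
      BalTensor.hom_ext fun _ _ => rfl
    exact LinearMap.congr_fun this z

/-- The underlying `R`-module of `▸P ⊗ M_◁`. -/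
noncomputable def tensorFunctorEquiv (M : CompleteLeft.{v} I U) :
    ((tensorFunctor hI hl hP).obj M).obj ≃ₗ[R] B.tensorA P M.obj :=
  haveI := AeRing.isAdicComplete_tensorA (M := M.obj) hI hP
  tensorModuleCatEquiv hI hl P M

theorem tensorFunctorEquiv_smul (M : CompleteLeft.{v} I U)
    [IsAdicComplete I (B.tensorA P M.obj)] (u : U)
    (z : ((tensorFunctor hI hl hP).obj M).obj) :
    tensorFunctorEquiv hI hl hP M (op u • z) =
      tensorRact hI hl u (tensorFunctorEquiv hI hl hP M z) := rfl

theorem tensorFunctorEquiv_map {M M' : CompleteLeft.{v} I U} (f : M ⟶ M')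
    (z : ((tensorFunctor hI hl hP).obj M).obj) :
    tensorFunctorEquiv hI hl hP M' (((tensorFunctor hI hl hP).map f).hom z) =
      tensorMap f.hom.hom (tensorFunctorEquiv hI hl hP M z) := rfl

theorem isTensorFunctor_tensorFunctor : IsTensorFunctor hl P (tensorFunctor hI hl hP) := by
  refine ⟨tensorFunctorEquiv hI hl hP, fun M p m u => ?_, fun M M' f p m => ?_⟩
  · have := AeRing.isAdicComplete_tensorA (M := M.obj) hI hP
    rw [tensorFunctorEquiv_smul, LinearEquiv.apply_symm_apply, tensorRact_tensorAMk,
      of_adicExtend]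
  · rw [tensorFunctorEquiv_map, LinearEquiv.apply_symm_apply]
    rfl

end Tensor

section Hom

variable (hr : B.IsRightHopf)

/-- `Hom(P, N)` as a left `U`-module. -/
noncomputable def homModuleCat (P : ModuleCat.{v} Uᵐᵒᵖ) (N : CompleteRight.{v} I U) :
    ModuleCat.{v} U :=
  letI := homLeftModule (P := P) (N := N.obj) hI hr
  ModuleCat.of U (B.homA P N.obj)

/-- The underlying `R`-module of `homModuleCat`. -/
noncomputable def homModuleCatEquiv (P : ModuleCat.{v} Uᵐᵒᵖ) (N : CompleteRight.{v} I U) :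
    homModuleCat hI hr P N ≃ₗ[R] B.homA P N.obj :=
  { (Equiv.refl _ : homModuleCat hI hr P N ≃ B.homA P N.obj) with
    map_add' := fun _ _ => rfl
    map_smul' := fun c φ => by
      change homLact hI hr (algebraMap R U c) _ = _
      rw [Algebra.algebraMap_eq_smul_one]
      exact (homLact_smul_left hI hr c 1 φ).trans
        (congrArg (c • ·) (one_smul U (show homModuleCat hI hr P N from φ))) }

variable (hP : B.IsFGProjectiveRight P)

/-- The functor `N ↦ Hom(P, N)`. -/
noncomputable def homFunctor : CompleteRight.{v} I U ⥤ CompleteLeft.{v} I U where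
  obj N :=
    haveI := AeRing.isAdicComplete_homA (N := N.obj) hI hP
    ⟨homModuleCat hI hr P N, isAdicComplete_of_retract
      (homModuleCatEquiv hI hr P N).toLinearMap (homModuleCatEquiv hI hr P N).symm.toLinearMap
      (homModuleCatEquiv hI hr P N).symm_apply_apply⟩
  map {N N'} f :=
    ObjectProperty.homMk (ModuleCat.ofHom (X := homModuleCat hI hr P N)
      (Y := homModuleCat hI hr P N')
      { toFun := homMap (B := B) (P := P) f.hom.hom
        map_add' := map_add (homMap (B := B) (P := P) f.hom.hom)
        map_smul' := fun u φ => homMap_homLact hI hr f.hom.hom u φ })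
  map_id _ := rfl
  map_comp _ _ := rfl

/-- The underlying `R`-module of `Hom(P, N)`. -/
noncomputable def homFunctorEquiv (N : CompleteRight.{v} I U) :
    ((homFunctor hI hr hP).obj N).obj ≃ₗ[R] B.homA P N.obj :=
  homModuleCatEquiv hI hr P N

theorem homFunctorEquiv_smul (N : CompleteRight.{v} I U) (u : U)
    (φ : ((homFunctor hI hr hP).obj N).obj) :
    homFunctorEquiv hI hr hP N (u • φ) = homLact hI hr u (homFunctorEquiv hI hr hP N φ) := rfl

theorem homFunctorEquiv_map {N N' : CompleteRight.{v} I U} (f : N ⟶ N')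
    (φ : ((homFunctor hI hr hP).obj N).obj) :
    homFunctorEquiv hI hr hP N' (((homFunctor hI hr hP).map f).hom φ) =
      homMap f.hom.hom (homFunctorEquiv hI hr hP N φ) := rfl

theorem isHomFunctor_homFunctor : IsHomFunctor hr P (homFunctor hI hr hP) := by
  refine ⟨homFunctorEquiv hI hr hP, fun N φ p u => ?_, fun N N' f φ p => ?_⟩
  · rw [homFunctorEquiv_smul, LinearEquiv.apply_symm_apply, homLact_apply, of_adicExtend]
  · rw [homFunctorEquiv_map, LinearEquiv.apply_symm_apply]
    rfl

end Hom

section Isomorphisms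

-- F and G enter only through comparison isomorphisms compatible with actions and morphisms, so the
-- unit and counit are built without unfolding the functors.
variable (hl : B.IsLeftHopf) (hr : B.IsRightHopf)
  [∀ M : CompleteLeft.{v} I U, IsAdicComplete I (B.tensorA P M.obj)]
  {F : CompleteLeft.{v} I U ⥤ CompleteRight.{v} I U}
  (θF : ∀ M, (F.obj M).obj ≃ₗ[R] B.tensorA P M.obj)
  (θF_smul : ∀ M u z, θF M (op u • z) = tensorRact hI hl u (θF M z))
  (θF_map : ∀ {M M'} (f : M ⟶ M') z, θF M' ((F.map f).hom z) = tensorMap f.hom.hom (θF M z))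
  {G : CompleteRight.{v} I U ⥤ CompleteLeft.{v} I U}
  (θG : ∀ N, (G.obj N).obj ≃ₗ[R] B.homA P N.obj)
  (θG_smul : ∀ N u φ, θG N (u • φ) = homLact hI hr u (θG N φ))
  (θG_map : ∀ {N N'} (f : N ⟶ N') φ, θG N' ((G.map f).hom φ) = homMap f.hom.hom (θG N φ))

/-- The unit `M ≃ Hom(P, P ⊗ M)`. -/
noncomputable def unitEquiv (hPr : B.IsFGProjectiveRight P)
    (h_end : Function.Bijective (fun a : A => (B.blact a : B.homA P P)))
    (M : CompleteLeft.{v} I U) : M.obj ≃ₗ[U] (G.obj (F.obj M)).obj :=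
  LinearEquiv.ofBijective
    { toFun := fun m => (θG (F.obj M)).symm (unitMap hI hl (θF M) (θF_smul M) m)
      map_add' := fun m m' => by rw [map_add, map_add]
      map_smul' := fun u m => by
        rw [RingHom.id_apply, LinearEquiv.symm_apply_eq, θG_smul,
          LinearEquiv.apply_symm_apply, unitMap_smul hI hl _ _ hr] }
    ((θG _).symm.bijective.comp (unitMap_bijective hI hl _ _ hPr h_end))

/-- As θF and θG are injective, this formula determines the unit; naturality is checked through it.
-/
theorem unitEquiv_apply (hPr : B.IsFGProjectiveRight P)
    (h_end : Function.Bijective (fun a : A => (B.blact a : B.homA P P)))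
    (M : CompleteLeft.{v} I U) (m : M.obj) (p : P) :
    θF M ((θG (F.obj M) (unitEquiv hI hl hr θF θF_smul θG θG_smul hPr h_end M m)).1 p) =
      B.tensorAMk p m := by
  rw [← unitMap_apply hI hl (θF M) (θF_smul M)]
  exact congrArg (fun φ => θF M (φ.1 p)) ((θG (F.obj M)).apply_symm_apply _)

/-- The natural isomorphism `M ≅ Hom(P, P ⊗ M)`. -/
noncomputable def unitIso (hPr : B.IsFGProjectiveRight P)
    (h_end : Function.Bijective (fun a : A => (B.blact a : B.homA P P))) :
    𝟭 (CompleteLeft.{v} I U) ≅ F ⋙ G :=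
  NatIso.ofComponents (fun M => ObjectProperty.isoMk _
      (unitEquiv hI hl hr θF θF_smul θG θG_smul hPr h_end M).toModuleIso)
    fun {M M'} f => by
      refine ObjectProperty.hom_ext _ (ModuleCat.hom_ext (LinearMap.ext fun m => ?_))
      refine (θG _).injective (Subtype.ext (LinearMap.ext fun p => (θF M').injective ?_))
      refine (unitEquiv_apply hI hl hr θF θF_smul θG θG_smul hPr h_end M' (f.hom m) p).trans ?_
      refine Eq.trans ?_ (congrArg (fun φ => θF M' (φ.1 p)) (θG_map (F.map f)
        (unitEquiv hI hl hr θF θF_smul θG θG_smul hPr h_end M m))).symm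
      refine Eq.trans ?_ (θF_map f _).symm
      exact (congrArg (tensorMap f.hom.hom)
        (unitEquiv_apply hI hl hr θF θF_smul θG θG_smul hPr h_end M m p)).symm

/-- The counit `P ⊗ Hom(P, N) ≃ N`. -/
noncomputable def counitEquiv
    (h_eval : ∀ N : CompleteRight.{v} I U, Function.Bijective (B.evalMap P N.obj))
    (N : CompleteRight.{v} I U) : (F.obj (G.obj N)).obj ≃ₗ[Uᵐᵒᵖ] N.obj :=
  LinearEquiv.ofBijective
    { toFun := fun z => counitMap hI hr (θG N) (θG_smul N) (θF (G.obj N) z)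
      map_add' := fun z z' => by rw [map_add, map_add]
      map_smul' := fun u z => by
        rw [RingHom.id_apply, ← op_unop u, θF_smul, counitMap_tensorRact] }
    ((counitMap_bijective hI hr (θG N) (θG_smul N) (h_eval N)).comp (θF _).bijective)

/-- The natural isomorphism `P ⊗ Hom(P, N) ≅ N`. -/
noncomputable def counitIso
    (h_eval : ∀ N : CompleteRight.{v} I U, Function.Bijective (B.evalMap P N.obj)) :
    G ⋙ F ≅ 𝟭 (CompleteRight.{v} I U) :=
  NatIso.ofComponents (fun N => ObjectProperty.isoMk _
      (counitEquiv hI hl hr θF θF_smul θG θG_smul h_eval N).toModuleIso)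
    fun {N N'} f => by
      refine ObjectProperty.hom_ext _ (ModuleCat.hom_ext (LinearMap.ext fun z => ?_))
      have h : counitMap hI hr (θG N') (θG_smul N') ∘ₗ tensorMap (G.map f).hom.hom =
          f.hom.hom.restrictScalars R ∘ₗ counitMap hI hr (θG N) (θG_smul N) :=
        BalTensor.hom_ext fun p φ => congrArg (fun ψ => ψ.1 p) (θG_map f φ)
      exact (congrArg (counitMap hI hr (θG N') (θG_smul N')) (θF_map (G.map f) z)).trans
        (LinearMap.congr_fun h (θF (G.obj N) z))

end Isomorphisms

end Constructions

/-- The equivalence between complete left and complete right `U`-modules given by `P`. -/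
theorem exists_tensor_hom_equivalence (hI : I.FG) (hl : B.IsLeftHopf) (hr : B.IsRightHopf)
    (hPr : B.IsFGProjectiveRight P) (hPl : B.IsFGProjectiveLeft P)
    (h_end : Function.Bijective (fun a : A => (B.blact a : B.homA P P)))
    (h_eval : ∀ N : CompleteRight.{v} I U, Function.Bijective (B.evalMap P N.obj)) :
    ∃ E : CompleteLeft.{v} I U ≌ CompleteRight.{v} I U,
      IsTensorFunctor hl P E.functor ∧ IsHomFunctor hr P E.inverse :=
  have (M : CompleteLeft.{v} I U) : IsAdicComplete I (B.tensorA P M.obj) :=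
    AeRing.isAdicComplete_tensorA hI hPl
  -- `Equivalence.mk` adjusts the unit to obtain the triangle identity, so the two natural
  -- isomorphisms suffice.
  ⟨CategoryTheory.Equivalence.mk (tensorFunctor hI hl hPl) (homFunctor hI hr hPr)
    (unitIso hI hl hr (tensorFunctorEquiv hI hl hPl) (fun M => tensorFunctorEquiv_smul hI hl hPl M)
      (tensorFunctorEquiv_map hI hl hPl) (homFunctorEquiv hI hr hPr)
      (homFunctorEquiv_smul hI hr hPr) (homFunctorEquiv_map hI hr hPr) hPr h_end)
    (counitIso hI hl hr (tensorFunctorEquiv hI hl hPl) (fun M => tensorFunctorEquiv_smul hI hl hPl M)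
      (tensorFunctorEquiv_map hI hl hPl) (homFunctorEquiv hI hr hPr)
      (homFunctorEquiv_smul hI hr hPr) (homFunctorEquiv_map hI hr hPr) h_eval),
    isTensorFunctor_tensorFunctor hI hl hPl, isHomFunctor_homFunctor hI hr hPr⟩

end Functors

end HopfAlgd

theorem mainTheorem9 {k : Type*} [CommRing k]
    {A : Type*} {U : Type*} [Ring A] [Algebra k A] [Ring U] [Algebra k U]
    {Ah : Type*} {Uh : Type*} [Ring Ah] [Algebra (PowerSeries k) Ah]
    [Ring Uh] [Algebra (PowerSeries k) Uh]
    (B : LeftBialgebroid (⊥ : Ideal k) A U) (Bh : LeftBialgebroid (hIdeal k) Ah Uh)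
    (quant : Quantisation B Bh) (hl : Bh.IsLeftHopf) (hr : Bh.IsRightHopf)
    (P : ModuleCat.{v} Uhᵐᵒᵖ)
    (hP_right : Bh.IsFGProjectiveRight P) (hP_left : Bh.IsFGProjectiveLeft P)
    (h_end : Function.Bijective (fun a : Ah => (Bh.blact a : Bh.homA P P)))
    (h_eval : ∀ N : CompleteRight.{v} (hIdeal k) Uh,
      Function.Bijective (Bh.evalMap P N.obj)) :
    ∃ E : CompleteLeft.{v} (hIdeal k) Uh ≌ CompleteRight.{v} (hIdeal k) Uh,
      IsTensorFunctor hl P E.functor ∧ IsHomFunctor hr P E.inverse :=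
  -- The ideal (h) is principal, hence finitely generated.
  exists_tensor_hom_equivalence (Submodule.fg_span_singleton _) hl hr hP_right hP_left h_end h_eval
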